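/- Setting. Let $\tau>0$, $s_\star>0$ and $\beta_0,\beta_\Delta,m_\star\in\mathbb R$. For every even $n\ge 4$ let $X\in\mathbb R^{n\times 2}$ be a matrix whose first column is $(1,\dots,1)^{\mathsf T}$ (intercept) and whose second column $x$ has $n/2$ entries equal to $1$ and $n/2$ entries equal to $-1$, in any order. The data are $y=X(\beta_0,\beta_\Delta)^{\mathsf T}+\varepsilon$ with $\varepsilon\sim\mathrm N(\mu_\star,\Sigma_\star)$, $\Sigma_\star=s_\star^2 I_n$, where $\mu_\star$ has all entries $0$ except possibly one entry $m_\star$, at an index $i_{\mathrm{out}}$ with $x_{i_{\mathrm{out}}}=1$ ($X$ and $i_{\mathrm{out}}$ may depend on $n$; $m_\star=0$ is allowed). Denote by $p_{\mathrm{true}}$ the law of $y$. Two Bayesian normal linear regression models with known noise variance $\tau^2$ and uniform (improper) prior on their coefficients $\theta$, $y\mid\theta\sim\mathrm N(Z\theta,\tau^2I)$, are compared: the null model $\mathrm M_a$, where $Z$ is the intercept column, and $\mathrm M_b$, where $Z=X$. For $k\in\{a,b\}$ let $p_k(\,\cdot\mid y)$ be the posterior predictive density, evaluated for the $i$-th observation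 at the $i$-th row of the model's design matrix, and put $$\mathrm{elpd}(\mathrm M_k\mid y)=\sum_{i=1}^n \mathbb E_{\tilde y\sim p_{\mathrm{true}}}\bigl[\log p_k(\tilde y_i\mid y)\bigr],\qquad \widehat{\mathrm{elpd}}_{\mathrm{LOO}}(\mathrm M_k\mid y)=\sum_{i=1}^n\log p_k(y_i\mid y_{-i}),$$ where $\tilde y$ is independent of $y$ and $y_{-i}$ is $y$ without its $i$-th entry. Let $\mathrm{elpd}(\mathrm M_a,\mathrm M_b\mid y)$ and $\widehat{\mathrm{elpd}}_{\mathrm{LOO}}(\mathrm M_a,\mathrm M_b\mid y)$ be the differences, $\mathrm M_a$ minus $\mathrm M_b$, and $\mathrm{err}_{\mathrm{LOO}}(\mathrm M_a,\mathrm M_b\mid y)=\widehat{\mathrm{elpd}}_{\mathrm{LOO}}(\mathrm M_a,\mathrm M_b\mid y)-\mathrm{elpd}(\mathrm M_a,\mathrm M_b\mid y)$. Claim. Taking mean $\mathbb E$, standard deviation $\mathrm{SD}$ and skewness over $y\sim p_{\mathrm{true}}$ (with the design fixed), the three random variables have finite third absolute moments and positive variances, and, as $n\to\infty$ through the even integers,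 $$\lim_{n\to\infty}\frac{\mathbb E[\widehat{\mathrm{elpd}}_{\mathrm{LOO}}(\mathrm M_a,\mathrm M_b\mid y)]}{\mathrm{SD}[\widehat{\mathrm{elpd}}_{\mathrm{LOO}}(\mathrm M_a,\mathrm M_b\mid y)]}=\lim_{n\to\infty}\frac{\mathbb E[\mathrm{elpd}(\mathrm M_a,\mathrm M_b\mid y)]}{\mathrm{SD}[\mathrm{elpd}(\mathrm M_a,\mathrm M_b\mid y)]}=\begin{cases}\dfrac{\tau^2}{\sqrt2\,s_\star^2},&\beta_\Delta=0,\\-\infty,&\beta_\Delta\ne0,\end{cases}$$ $$\lim_{n\to\infty}\frac{\mathbb E[\mathrm{err}_{\mathrm{LOO}}(\mathrm M_a,\mathrm M_b\mid y)]}{\mathrm{SD}[\mathrm{err}_{\mathrm{LOO}}(\mathrm M_a,\mathrm M_b\mid y)]}=0,\qquad \lim_{n\to\infty}\mathrm{skewness}[\mathrm{err}_{\mathrm{LOO}}(\mathrm M_a,\mathrm M_b\mid y)]=\begin{cases}-2^{3/2},&\beta_\Delta=0,\\0,&\beta_\Delta\ne0.\end{cases}$$ -/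

import Mathlib

open MeasureTheory ProbabilityTheory Filter Topology
open scoped NNReal Matrix

namespace LinRegCV

noncomputable section

/-- The law of the data `y = X β + ε`, where `ε ∼ N(μ, s² I)`, that is, the noise coordinates are
independent with `ε i ∼ N(μ i, s²)`. -/
def dataLaw {ι κ : Type*} [Fintype ι] [Fintype κ]
    (X : Matrix ι κ ℝ) (β : κ → ℝ) (μ : ι → ℝ) (s : ℝ≥0) : Measure (ι → ℝ) :=
  (Measure.pi fun i => gaussianReal (μ i) (s ^ 2)).map fun ε => X *ᵥ β + ε

/-- The likelihood `N(y | Z θ, τ² I)` of the normal linear regression model with design matrix `Z`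
(one row per observation), fixed noise variance `τ²` and unknown coefficient vector `θ`. -/
def likelihood {ι κ : Type*} [Fintype ι] [Fintype κ]
    (τ : ℝ≥0) (Z : Matrix ι κ ℝ) (y : ι → ℝ) (θ : κ → ℝ) : ℝ :=
  ∏ i, gaussianPDFReal ((Z *ᵥ θ) i) (τ ^ 2) (y i)

/-- The posterior density of `θ` given `y` under the uniform (Lebesgue) prior on `θ`. -/
def posteriorDensity {ι κ : Type*} [Fintype ι] [Fintype κ]
    (τ : ℝ≥0) (Z : Matrix ι κ ℝ) (y : ι → ℝ) (θ : κ → ℝ) : ℝ :=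
  likelihood τ Z y θ / ∫ η : κ → ℝ, likelihood τ Z y η

/-- The posterior predictive density at `t` of a new response with covariate row `z`,
given the data `y` with design matrix `Z`. -/
def predictiveDensity {ι κ : Type*} [Fintype ι] [Fintype κ]
    (τ : ℝ≥0) (Z : Matrix ι κ ℝ) (y : ι → ℝ) (z : κ → ℝ) (t : ℝ) : ℝ :=
  ∫ θ : κ → ℝ, gaussianPDFReal (z ⬝ᵥ θ) (τ ^ 2) t * posteriorDensity τ Z y θ

/-- Expected log pointwise predictive density `∑ i, E[log p(ỹ i | y)]` of the model with design
matrix `Z` fitted to `y`, where `ỹ` is a new data set with law `P`. -/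
def elpd {ι κ : Type*} [Fintype ι] [Fintype κ]
    (P : Measure (ι → ℝ)) (τ : ℝ≥0) (Z : Matrix ι κ ℝ) (y : ι → ℝ) : ℝ :=
  ∑ i, ∫ w, Real.log (predictiveDensity τ Z y (Z i) (w i)) ∂P

/-- Leave-one-out cross-validation estimate `∑ i, log p(y i | y without i)` of the elpd. -/
def elpdLOO {ι κ : Type*} [Fintype ι] [DecidableEq ι] [Fintype κ]
    (τ : ℝ≥0) (Z : Matrix ι κ ℝ) (y : ι → ℝ) : ℝ :=
  ∑ i, Real.log (predictiveDensity τ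
    (Z.submatrix (fun j : {j : ι // j ≠ i} => (j : ι)) id)
    (fun j : {j : ι // j ≠ i} => y j) (Z i) (y i))

/-- The columns of `X` that belong to the set `d` of covariates. -/
def columns {ι κ : Type*} (X : Matrix ι κ ℝ) (d : Finset κ) : Matrix ι {c : κ // c ∈ d} ℝ :=
  X.submatrix id fun c => (c : κ)

/-- The elpd difference of the models `a` and `b` using the covariate sets `da` and `db`. -/
def elpdDiff {ι κ : Type*} [Fintype ι] [Fintype κ]
    (P : Measure (ι → ℝ)) (τ : ℝ≥0) (X : Matrix ι κ ℝ) (da db : Finset κ) (y : ι → ℝ) : ℝ :=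
  elpd P τ (columns X da) y - elpd P τ (columns X db) y

/-- The leave-one-out estimate of the elpd difference. -/
def looDiff {ι κ : Type*} [Fintype ι] [DecidableEq ι] [Fintype κ]
    (τ : ℝ≥0) (X : Matrix ι κ ℝ) (da db : Finset κ) (y : ι → ℝ) : ℝ :=
  elpdLOO τ (columns X da) y - elpdLOO τ (columns X db) y

/-- The error of the leave-one-out estimate of the elpd difference. -/
def looError {ι κ : Type*} [Fintype ι] [DecidableEq ι] [Fintype κ]
    (P : Measure (ι → ℝ)) (τ : ℝ≥0) (X : Matrix ι κ ℝ) (da db : Finset κ) (y : ι → ℝ) : ℝ :=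
  looDiff τ X da db y - elpdDiff P τ X da db y

/-- The mean of `f` relative to its standard deviation. -/
def meanOverSD {Ω : Type*} [MeasurableSpace Ω] (P : Measure Ω) (f : Ω → ℝ) : ℝ :=
  (∫ ω, f ω ∂P) / √(variance f P)

/-- The skewness of `f`: third central moment over the `3/2` power of the variance. -/
def skewness {Ω : Type*} [MeasurableSpace Ω] (P : Measure Ω) (f : Ω → ℝ) : ℝ :=
  centralMoment f 3 P / (variance f P) ^ (3 / 2 : ℝ)

/-- The design matrix with an intercept column of ones (column `0`) and one covariate `x`
(column `1`). -/
def interceptDesign {ι : Type*} (x : ι → ℝ) : Matrix ι (Fin 2) ℝ :=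
  Matrix.of fun i => ![1, x i]

end

end LinRegCV

/-! Write `q = 1 / √n` and standardize the data as `y i = ν i + s * z i` with independent standard
Gaussian `z i`. With a flat prior the predictive densities are Gaussian. In the balanced `±1` design
the larger model splits into two groups with separate means, so both elpd differences reduce to a
logarithmic constant plus weighted sums of squares (`looDiff_eq`, `elpdDiff_eq`).

In terms of `z`, each difference is its mean plus a linear combination of six centred noise terms
(`looDiff_expansion`, `elpdDiff_expansion`). The decisive one comes from `W = q * ∑ i, x i * z i`,
which is exactly standard Gaussian. The fourth moments of all six terms are bounded uniformly in `n`
(`noiseTerm_moments`). Hence variances and third central moments, after rescaling, depend in the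
limit only on the limits of the coefficients (`tendsto_integral_pow_sub`,
`tendsto_rescaled_moments`), and no central limit theorem is needed.

For slope zero only `W ^ 2 - 1` survives, with coefficient `-s ^ 2 / (2 * τ ^ 2)` for leave-one-out
and `+s ^ 2 / (2 * τ ^ 2)` for the elpd. Both means tend to `1 / 2`, which gives the common ratio.
In the error the two quadratic terms add up instead of cancelling, while the means cancel. The limit
is a negative multiple of a centred chi-square variable with one degree of freedom, whence skewness
`-2 ^ (3 / 2)`.

For slope `b ≠ 0` both means are of order `-n * b ^ 2 / (2 * τ ^ 2)`. The leave-one-out difference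
and the error have standard deviation of order `√n`, coming from a term linear in `W`; that of the
elpd difference stays bounded. So the first two ratios diverge to `-∞`. The means of order `n`
cancel in the error up to a bounded remainder, and its Gaussian limit has skewness zero. -/

namespace LinRegCV

/-! ### Gaussian predictive densities under a flat prior -/

/-- Completing the square in `u`; the right side isolates the dependence on `u` in one normalized
density, so that `u` can be integrated out. -/
lemma gaussianPDFReal_mul_gaussianPDFReal {v w : ℝ≥0} (hv : 0 < v) (hw : 0 < w) (t c u : ℝ) :
    gaussianPDFReal u v t * gaussianPDFReal c w u =
      gaussianPDFReal c (v + w) t *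
        gaussianPDFReal ((w * t + v * c) / (v + w)) (v * w / (v + w)) u := by
  have hv' : (0 : ℝ) < v := hv
  have hw' : (0 : ℝ) < w := hw
  simp only [gaussianPDFReal]
  push_cast
  rw [mul_mul_mul_comm, mul_mul_mul_comm (√(2 * Real.pi * (v + w)))⁻¹, ← Real.exp_add, ← Real.exp_add, ← mul_inv,
    ← mul_inv, ← Real.sqrt_mul (by positivity), ← Real.sqrt_mul (by positivity)]
  congr 2
  · congr 1
    field_simp
  · field_simp
    ring

lemma integral_gaussianPDFReal_mul_gaussianPDFReal {v w : ℝ≥0} (hv : 0 < v) (hw : 0 < w)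
    (t c : ℝ) :
    ∫ u, gaussianPDFReal u v t * gaussianPDFReal c w u = gaussianPDFReal c (v + w) t := by
  simp_rw [gaussianPDFReal_mul_gaussianPDFReal hv hw t c]
  rw [integral_const_mul, integral_gaussianPDFReal_eq_one, mul_one]
  positivity

/-- As a function of its mean, the likelihood of a Gaussian sample is proportional to the
Gaussian density around the sample average. -/
lemma exists_prod_gaussianPDFReal_eq {ι : Type*} (S : Finset ι) (hS : S.Nonempty) {v : ℝ≥0}
    (hv : 0 < v) (y : ι → ℝ) :
    ∃ C : ℝ, C ≠ 0 ∧ ∀ u, ∏ i ∈ S, gaussianPDFReal u v (y i) =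
      C * gaussianPDFReal ((∑ i ∈ S, y i) / S.card) (v / S.card) u := by
  have hv' : (0 : ℝ) < v := hv
  have hc : (0 : ℝ) < S.card := by exact_mod_cast hS.card_pos
  set a := (∑ i ∈ S, y i) / S.card with ha
  have hsum : ∑ i ∈ S, y i = S.card * a := by rw [ha]; field_simp
  refine ⟨(√(2 * Real.pi * v))⁻¹ ^ S.card * √(2 * Real.pi * (v / S.card)) *
    Real.exp (-(∑ i ∈ S, (y i - a) ^ 2) / (2 * v)), ?_, fun u => ?_⟩
  · have hs := Real.sqrt_pos.2 (mul_pos Real.two_pi_pos (div_pos hv' hc))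
    have hs' := Real.sqrt_pos.2 (mul_pos Real.two_pi_pos hv')
    exact (mul_pos (mul_pos (pow_pos (inv_pos.2 hs') _) hs) (Real.exp_pos _)).ne'
  -- Splitting the squares around the sample average leaves a single term that depends on `u`.
  · have h2 : ∑ i ∈ S, (y i - u) ^ 2 = ∑ i ∈ S, (y i - a) ^ 2 + S.card * (u - a) ^ 2 := by
      have : ∀ i ∈ S, (y i - u) ^ 2 = (y i - a) ^ 2 + (2 * (a - u) * y i + (u ^ 2 - a ^ 2)) :=
        fun i _ => by ring
      rw [Finset.sum_congr rfl this, Finset.sum_add_distrib, Finset.sum_add_distrib,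
        ← Finset.mul_sum, hsum, Finset.sum_const, nsmul_eq_mul]
      ring
    simp only [gaussianPDFReal]
    rw [Finset.prod_mul_distrib, Finset.prod_const, ← Real.exp_sum, ← Finset.sum_div,
      Finset.sum_neg_distrib, h2]
    push_cast
    have hs := (Real.sqrt_pos.2 (mul_pos Real.two_pi_pos (div_pos hv' hc))).ne'
    have e : -(∑ i ∈ S, (y i - a) ^ 2 + S.card * (u - a) ^ 2) / (2 * (v : ℝ)) =
      -(∑ i ∈ S, (y i - a) ^ 2) / (2 * v) + -(u - a) ^ 2 / (2 * (v / S.card)) := by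
      field_simp
      ring
    rw [e, Real.exp_add, mul_assoc _ (√_), mul_comm (√_), mul_assoc, mul_assoc, mul_assoc,
      mul_inv_cancel_left₀ hs]

lemma integral_prod_gaussianPDFReal_ne_zero {ι : Type*} (S : Finset ι) (hS : S.Nonempty)
    {v : ℝ≥0} (hv : 0 < v) (y : ι → ℝ) : ∫ u, ∏ i ∈ S, gaussianPDFReal u v (y i) ≠ 0 := by
  obtain ⟨C, hC, h⟩ := exists_prod_gaussianPDFReal_eq S hS hv y
  have hc : (0 : ℝ≥0) < S.card := by exact_mod_cast hS.card_pos
  simp_rw [h]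
  rw [integral_const_mul, integral_gaussianPDFReal_eq_one, mul_one]
  · exact hC
  · exact (div_pos hv hc).ne'

/-- The likelihood integral is kept as a factor because it cancels against the normalization of the
posterior. -/
lemma integral_gaussianPDFReal_mul_prod {ι : Type*} (S : Finset ι) (hS : S.Nonempty)
    {v : ℝ≥0} (hv : 0 < v) (y : ι → ℝ) (t : ℝ) :
    ∫ u, gaussianPDFReal u v t * ∏ i ∈ S, gaussianPDFReal u v (y i) =
      gaussianPDFReal ((∑ i ∈ S, y i) / S.card) (v + v / S.card) t *
        ∫ u, ∏ i ∈ S, gaussianPDFReal u v (y i) := by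
  obtain ⟨C, hC, h⟩ := exists_prod_gaussianPDFReal_eq S hS hv y
  have hc : (0 : ℝ≥0) < S.card := by exact_mod_cast hS.card_pos
  have hw : 0 < v / S.card := div_pos hv hc
  simp_rw [h, mul_left_comm _ C]
  rw [integral_const_mul, integral_const_mul, integral_gaussianPDFReal_eq_one _ hw.ne',
    integral_gaussianPDFReal_mul_gaussianPDFReal hv hw]
  ring

/-- Uniqueness of Haar measure up to scaling. The value of `c` is irrelevant: it occurs in numerator
and denominator of the posterior predictive density, so no determinant has to be computed. -/
lemma exists_integral_comp_continuousLinearEquiv {E F : Type*}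
    [NormedAddCommGroup E] [NormedSpace ℝ E] [FiniteDimensional ℝ E] [MeasureSpace E]
    [BorelSpace E] [(volume : Measure E).IsAddHaarMeasure]
    [NormedAddCommGroup F] [NormedSpace ℝ F] [FiniteDimensional ℝ F] [MeasureSpace F]
    [BorelSpace F] [(volume : Measure F).IsAddHaarMeasure] (L : E ≃L[ℝ] F) :
    ∃ c : ℝ, c ≠ 0 ∧ ∀ f : F → ℝ, ∫ θ, f (L θ) = c * ∫ η, f η := by
  have : (Measure.map L (volume : Measure E)).IsAddHaarMeasure :=
    L.isAddHaarMeasure_map volume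
  have h := Measure.isAddLeftInvariant_eq_smul (Measure.map L (volume : Measure E))
    (volume : Measure F)
  refine ⟨_, (NNReal.coe_pos.2 (Measure.addHaarScalarFactor_pos_of_isAddHaarMeasure
    (Measure.map L (volume : Measure E)) (volume : Measure F))).ne', fun f => ?_⟩
  rw [← smul_eq_mul, ← NNReal.smul_def, ← integral_smul_nnreal_measure, ← h,
    show (L : E → F) = L.toHomeomorph.toMeasurableEquiv from rfl, integral_map_equiv]

/-- Posterior predictive density of a model with a single common mean. -/
lemma predictiveDensity_of_equiv_real {ι κ : Type*} [Fintype ι] [Nonempty ι] [Fintype κ]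
    {τ : ℝ≥0} (hτ : 0 < τ) (Z : Matrix ι κ ℝ) (y : ι → ℝ) (z : κ → ℝ) (t : ℝ)
    (L : (κ → ℝ) ≃L[ℝ] ℝ) (hZ : ∀ i θ, (Z *ᵥ θ) i = L θ) (hz : ∀ θ, z ⬝ᵥ θ = L θ) :
    predictiveDensity τ Z y z t =
      gaussianPDFReal ((∑ i, y i) / Fintype.card ι) (τ ^ 2 + τ ^ 2 / Fintype.card ι) t := by
  obtain ⟨c, hc, hL⟩ := exists_integral_comp_continuousLinearEquiv L
  have hv : 0 < τ ^ 2 := by positivity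
  simp only [predictiveDensity, posteriorDensity, likelihood, hZ, hz]
  have e := hL fun u => ∏ i, gaussianPDFReal u (τ ^ 2) (y i)
  have e' := hL fun u => gaussianPDFReal u (τ ^ 2) t * ∏ i, gaussianPDFReal u (τ ^ 2) (y i)
  rw [integral_gaussianPDFReal_mul_prod _ Finset.univ_nonempty hv] at e'
  have := integral_prod_gaussianPDFReal_ne_zero Finset.univ Finset.univ_nonempty hv y
  simp only [← mul_div_assoc]
  rw [integral_div, e, e', Finset.card_univ]
  field_simp

/-- Posterior predictive density of a model with two free group means: only the observations of
the group in question matter. -/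
lemma predictiveDensity_of_equiv_prod {ι κ : Type*} [Fintype ι] [Fintype κ]
    {τ : ℝ≥0} (hτ : 0 < τ) (Z : Matrix ι κ ℝ) (y : ι → ℝ) (z : κ → ℝ) (t : ℝ)
    (L : (κ → ℝ) ≃L[ℝ] ℝ × ℝ) (p : ι → Prop) [DecidablePred p]
    (hp : (Finset.univ.filter p).Nonempty) (hp' : (Finset.univ.filter fun i => ¬ p i).Nonempty)
    (hZ : ∀ i θ, p i → (Z *ᵥ θ) i = (L θ).1) (hZ' : ∀ i θ, ¬ p i → (Z *ᵥ θ) i = (L θ).2)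
    (hz : ∀ θ, z ⬝ᵥ θ = (L θ).1) :
    predictiveDensity τ Z y z t =
      gaussianPDFReal ((∑ i with p i, y i) / (Finset.univ.filter p).card)
        (τ ^ 2 + τ ^ 2 / (Finset.univ.filter p).card) t := by
  obtain ⟨c, hc, hL⟩ := exists_integral_comp_continuousLinearEquiv L
  have hv : 0 < τ ^ 2 := by positivity
  have hl : ∀ θ, likelihood τ Z y θ = (∏ i with p i, gaussianPDFReal (L θ).1 (τ ^ 2) (y i)) *
      ∏ i with ¬ p i, gaussianPDFReal (L θ).2 (τ ^ 2) (y i) := by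
    intro θ
    rw [likelihood, ← Finset.prod_filter_mul_prod_filter_not Finset.univ p]
    congr 1 <;> refine Finset.prod_congr rfl fun i hi => ?_
    · rw [hZ i θ (Finset.mem_filter.1 hi).2]
    · rw [hZ' i θ (Finset.mem_filter.1 hi).2]
  simp only [predictiveDensity, posteriorDensity, hl, hz]
  have e := hL fun u => (∏ i with p i, gaussianPDFReal u.1 (τ ^ 2) (y i)) *
      ∏ i with ¬ p i, gaussianPDFReal u.2 (τ ^ 2) (y i)
  have e' := hL fun u => (gaussianPDFReal u.1 (τ ^ 2) t *
    ∏ i with p i, gaussianPDFReal u.1 (τ ^ 2) (y i)) *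
      ∏ i with ¬ p i, gaussianPDFReal u.2 (τ ^ 2) (y i)
  rw [Measure.volume_eq_prod, integral_prod_mul (fun u => ∏ i with p i, gaussianPDFReal u _ (y i))
    (fun u => ∏ i with ¬ p i, gaussianPDFReal u _ (y i))] at e
  rw [Measure.volume_eq_prod, integral_prod_mul (fun u => gaussianPDFReal u (τ ^ 2) t *
      ∏ i with p i, gaussianPDFReal u _ (y i))
    (fun u => ∏ i with ¬ p i, gaussianPDFReal u _ (y i)),
    integral_gaussianPDFReal_mul_prod _ hp hv] at e'
  have h1 := integral_prod_gaussianPDFReal_ne_zero _ hp hv y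
  have h2 := integral_prod_gaussianPDFReal_ne_zero _ hp' hv y
  simp only [← mul_div_assoc, ← mul_assoc]
  rw [integral_div, e, e']
  field_simp

lemma log_gaussianPDFReal (c : ℝ) {v : ℝ≥0} (hv : 0 < v) (t : ℝ) :
    Real.log (gaussianPDFReal c v t) =
      -(1 / 2) * Real.log (2 * Real.pi * v) - (t - c) ^ 2 / (2 * v) := by
  have hv' : (0 : ℝ) < v := hv
  rw [gaussianPDFReal, Real.log_mul (by positivity) (by positivity), Real.log_exp, Real.log_inv,
    Real.log_sqrt (by positivity)]
  ring

/-! ### Group means as coordinates for the two models -/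

section Columns

variable {ι : Type*} [Fintype ι]

/-- Coordinate on the parameter space of the intercept model. -/
noncomputable def interceptEquiv : ({c : Fin 2 // c ∈ ({0} : Finset (Fin 2))} → ℝ) ≃L[ℝ] ℝ :=
  LinearEquiv.toContinuousLinearEquiv
    { toFun := fun θ => θ ⟨0, by simp⟩
      map_add' := fun _ _ => rfl
      map_smul' := fun _ _ => rfl
      invFun := fun u _ => u
      left_inv := fun θ => by
        funext ⟨c, hc⟩
        obtain rfl : c = 0 := by simpa using hc
        rfl
      right_inv := fun _ => rfl }

/-- The group means `θ₀ + σ θ₁` and `θ₀ - σ θ₁` as coordinates on the parameter space of the model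
with intercept and covariate. -/
noncomputable def groupEquiv (σ : ℝ) (hσ : σ = 1 ∨ σ = -1) :
    ({c : Fin 2 // c ∈ ({0, 1} : Finset (Fin 2))} → ℝ) ≃L[ℝ] ℝ × ℝ :=
  LinearEquiv.toContinuousLinearEquiv
    { toFun := fun θ => (θ ⟨0, by simp⟩ + σ * θ ⟨1, by simp⟩, θ ⟨0, by simp⟩ - σ * θ ⟨1, by simp⟩)
      map_add' := fun θ η => by
        ext <;> simp only [Pi.add_apply, Prod.mk_add_mk] <;> ring
      map_smul' := fun a θ => by
        ext <;> simp only [Pi.smul_apply, Prod.smul_mk, smul_eq_mul, RingHom.id_apply] <;> ring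
      -- Multiplication by `σ` serves as division by `σ`, since `σ ^ 2 = 1`.
      invFun := fun u c => if c.1 = 0 then (u.1 + u.2) / 2 else σ * (u.1 - u.2) / 2
      left_inv := fun θ => by
        funext ⟨c, hc⟩
        fin_cases c
        · simp
        · rcases hσ with rfl | rfl <;> simp
      right_inv := fun u => by
        rcases hσ with rfl | rfl <;> ext <;> simp <;> ring }

lemma predictiveDensity_intercept [Nonempty ι] {τ : ℝ≥0} (hτ : 0 < τ)
    (Z : Matrix ι {c : Fin 2 // c ∈ ({0} : Finset (Fin 2))} ℝ)
    (z : {c : Fin 2 // c ∈ ({0} : Finset (Fin 2))} → ℝ)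
    (hZ : ∀ i, Z i ⟨0, by simp⟩ = 1) (hz : z ⟨0, by simp⟩ = 1) (y : ι → ℝ) (t : ℝ) :
    predictiveDensity τ Z y z t =
      gaussianPDFReal ((∑ i, y i) / Fintype.card ι) (τ ^ 2 + τ ^ 2 / Fintype.card ι) t := by
  have key : ∀ w θ : {c : Fin 2 // c ∈ ({0} : Finset (Fin 2))} → ℝ, w ⟨0, by simp⟩ = 1 →
      w ⬝ᵥ θ = interceptEquiv θ := by
    intro w θ hw
    have hu : (Finset.univ : Finset {c : Fin 2 // c ∈ ({0} : Finset (Fin 2))}) =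
      {⟨0, by simp⟩} := by decide
    rw [dotProduct, hu, Finset.sum_singleton, hw, one_mul]
    rfl
  exact predictiveDensity_of_equiv_real hτ Z y z t interceptEquiv
    (fun i θ => key (Z i) θ (hZ i)) (fun θ => key z θ hz)

/-- Since `σ` and `x i` are signs, `(1 + σ * x i) / 2` is the indicator of `x i = σ`. Group size and
group sum thus become linear in `x` and follow directly from `∑ i, x i = 0`. The other group must be
nonempty for its likelihood to integrate to a nonzero number, which then cancels. -/
lemma predictiveDensity_group {τ : ℝ≥0} (hτ : 0 < τ)
    (Z : Matrix ι {c : Fin 2 // c ∈ ({0, 1} : Finset (Fin 2))} ℝ)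
    (z : {c : Fin 2 // c ∈ ({0, 1} : Finset (Fin 2))} → ℝ) (x : ι → ℝ) (σ : ℝ)
    (hx : ∀ i, x i = 1 ∨ x i = -1) (hσ : σ = 1 ∨ σ = -1)
    (hZ : ∀ i, Z i ⟨0, by simp⟩ = 1 ∧ Z i ⟨1, by simp⟩ = x i)
    (hz : z ⟨0, by simp⟩ = 1 ∧ z ⟨1, by simp⟩ = σ) (y : ι → ℝ) (t : ℝ) {S N : ℝ}
    (hN : ∑ i, (1 + σ * x i) / 2 = N) (hN0 : 0 < N) (hN' : 0 < ∑ i, (1 - σ * x i) / 2)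
    (hS : ∑ i, (1 + σ * x i) / 2 * y i = S) {v : ℝ≥0} (hv : (v : ℝ) = τ ^ 2 + τ ^ 2 / N) :
    predictiveDensity τ Z y z t = gaussianPDFReal (S / N) v t := by
  classical
  have key : ∀ w θ : {c : Fin 2 // c ∈ ({0, 1} : Finset (Fin 2))} → ℝ, w ⟨0, by simp⟩ = 1 →
      w ⬝ᵥ θ = θ ⟨0, by simp⟩ + w ⟨1, by simp⟩ * θ ⟨1, by simp⟩ := by
    intro w θ hw
    have hu : (Finset.univ : Finset {c : Fin 2 // c ∈ ({0, 1} : Finset (Fin 2))}) =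
      {⟨0, by simp⟩, ⟨1, by simp⟩} := by decide
    rw [dotProduct, hu, Finset.sum_pair (by simp), hw, one_mul]
  have hind : ∀ i, (1 + σ * x i) / 2 = if x i = σ then (1 : ℝ) else 0 := by
    intro i
    rcases hx i with h | h <;> rcases hσ with h' | h' <;> rw [h, h'] <;> norm_num
  have hind' : ∀ i, (1 - σ * x i) / 2 = if ¬ x i = σ then (1 : ℝ) else 0 := by
    intro i
    rcases hx i with h | h <;> rcases hσ with h' | h' <;> rw [h, h'] <;> norm_num
  have hcard : ((Finset.univ.filter fun i => x i = σ).card : ℝ) = N := by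
    rw [← hN, Finset.sum_congr rfl fun i _ => hind i, Finset.sum_boole]
  have hcard' : 0 < (Finset.univ.filter fun i => ¬ x i = σ).card := by
    rw [Finset.sum_congr rfl fun i _ => hind' i, Finset.sum_boole] at hN'
    exact_mod_cast hN'
  have hne : 0 < (Finset.univ.filter fun i => x i = σ).card := by
    rw [← hcard] at hN0
    exact_mod_cast hN0
  have hsum : ∑ i with x i = σ, y i = S := by
    rw [← hS, Finset.sum_filter]
    exact Finset.sum_congr rfl fun i _ => by rw [hind]; simp
  rw [predictiveDensity_of_equiv_prod hτ Z y z t (groupEquiv σ hσ) (fun i => x i = σ)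
    (Finset.card_pos.1 hne) (Finset.card_pos.1 hcard'), hsum, hcard]
  · congr 1
    apply NNReal.coe_injective
    rw [hv]
    push_cast
    rw [hcard]
  · intro i θ hi
    refine (key (Z i) θ (hZ i).1).trans ?_
    rw [(hZ i).2, hi]
    rfl
  · intro i θ hi
    refine (key (Z i) θ (hZ i).1).trans ?_
    have : x i = -σ := by
      rcases hx i with h | h <;> rcases hσ with h' | h' <;>
        first | exact absurd (h.trans h'.symm) hi | (rw [h, h']; try norm_num)
    rw [(hZ i).2, this, neg_mul, ← sub_eq_add_neg]
    rfl
  · intro θ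
    refine (key z θ hz.1).trans ?_
    rw [hz.2]
    rfl

end Columns

/-! ### Closed forms of the elpd differences -/

section ClosedForms

variable {ι : Type*} [Fintype ι]

/-- The sample mean. -/
noncomputable def mean (y : ι → ℝ) : ℝ := (∑ i, y i) / Fintype.card ι

/-- The least-squares slope for a balanced covariate with values `1` and `-1`. -/
noncomputable def slope (x y : ι → ℝ) : ℝ := (∑ i, x i * y i) / Fintype.card ι

lemma sum_subtype_ne [DecidableEq ι] (i : ι) (f : ι → ℝ) :
    ∑ j : {j : ι // j ≠ i}, f j = (∑ j, f j) - f i := by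
  rw [← Finset.sum_subtype (Finset.univ.erase i) (by simp) f, Finset.sum_erase_eq_sub
    (Finset.mem_univ i)]

/-- Leaving out observation `i` multiplies its residual by `n / (n - 1)`, and the predictive
variance is `τ ^ 2 * (n / (n - 1))`. One factor `n / (n - 1)` therefore remains in the exponent. -/
lemma elpdLOO_intercept [DecidableEq ι] {τ : ℝ≥0} (hτ : 0 < τ) (x y : ι → ℝ)
    (hn : 4 ≤ Fintype.card ι) {n : ℝ} (hnc : (Fintype.card ι : ℝ) = n) :
    elpdLOO τ (columns (interceptDesign x) {0}) y =
      ∑ i, (-(1 / 2) * Real.log (2 * Real.pi * (τ ^ 2 * (n / (n - 1)))) -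
        n / (n - 1) / (2 * τ ^ 2) * (y i - mean y) ^ 2) := by
  refine Finset.sum_congr rfl fun i _ => ?_
  have hτ' : (0 : ℝ) < τ := hτ
  have hn4 : (4 : ℝ) ≤ n := by rw [← hnc]; exact_mod_cast hn
  have hcard : (Fintype.card {j : ι // j ≠ i} : ℝ) = n - 1 := by
    rw [← hnc, ← Finset.card_univ, Finset.cast_card, sum_subtype_ne i fun _ => (1 : ℝ)]
    simp
  have : Nonempty {j : ι // j ≠ i} := by
    rw [← Fintype.card_pos_iff, ← Nat.cast_pos (α := ℝ), hcard]
    linarith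
  rw [predictiveDensity_intercept hτ _ _ (fun j => by simp [columns, interceptDesign])
    (by simp [columns, interceptDesign]), log_gaussianPDFReal _ (by positivity),
    sum_subtype_ne i y, mean, hnc]
  push_cast
  rw [hcard]
  have h1 : n - 1 ≠ 0 := by linarith
  have e : (τ : ℝ) ^ 2 + τ ^ 2 / (n - 1) = τ ^ 2 * (n / (n - 1)) := by
    field_simp
    ring
  rw [e]
  congr 1
  field_simp
  ring

/-- The same mechanism inside a group of size `n / 2`, where the factor is `(n / 2) / (n / 2 - 1) =
n / (n - 2)`. -/
lemma elpdLOO_group [DecidableEq ι] {τ : ℝ≥0} (hτ : 0 < τ) (x y : ι → ℝ)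
    (hx : ∀ i, x i = 1 ∨ x i = -1) (hbal : ∑ i, x i = 0)
    (hn : 4 ≤ Fintype.card ι) {n : ℝ} (hnc : (Fintype.card ι : ℝ) = n) :
    elpdLOO τ (columns (interceptDesign x) {0, 1}) y =
      ∑ i, (-(1 / 2) * Real.log (2 * Real.pi * (τ ^ 2 * (n / (n - 2)))) -
        n / (n - 2) / (2 * τ ^ 2) * (y i - mean y - x i * slope x y) ^ 2) := by
  refine Finset.sum_congr rfl fun i _ => ?_
  have hτ' : (0 : ℝ) < τ := hτ
  have hn4 : (4 : ℝ) ≤ n := by rw [← hnc]; exact_mod_cast hn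
  have hxi : x i * x i = 1 := by rcases hx i with h | h <;> rw [h] <;> norm_num
  have hN : ∑ j : {j : ι // j ≠ i}, (1 + x i * x j) / 2 = n / 2 - 1 := by
    rw [sum_subtype_ne i fun j => (1 + x i * x j) / 2, ← Finset.sum_div, Finset.sum_add_distrib,
      ← Finset.mul_sum, hbal, hxi]
    simp [hnc]
  have hN' : ∑ j : {j : ι // j ≠ i}, (1 - x i * x j) / 2 = n / 2 := by
    rw [sum_subtype_ne i fun j => (1 - x i * x j) / 2, ← Finset.sum_div, Finset.sum_sub_distrib,
      -- The group of `i` loses one member, while the opposite group keeps all `n / 2`.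
      ← Finset.mul_sum, hbal, hxi]
    simp [hnc]
  have hS : ∑ j : {j : ι // j ≠ i}, (1 + x i * x j) / 2 * y j =
      n / 2 * (mean y + x i * slope x y) - y i := by
    rw [sum_subtype_ne i fun j => (1 + x i * x j) / 2 * y j, hxi, mean, slope, hnc]
    have : ∀ j, (1 + x i * x j) / 2 * y j = y j / 2 + x i / 2 * (x j * y j) := fun j => by ring
    rw [Finset.sum_congr rfl fun j _ => this j, Finset.sum_add_distrib, ← Finset.sum_div,
      ← Finset.mul_sum]
    field_simp
    ring
  have hpos : 0 < n / 2 - 1 := by linarith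
  have h1 : n - 2 ≠ 0 := by linarith
  have hv0 : 0 < (τ : ℝ) ^ 2 * (n / (n - 2)) :=
    mul_pos (by positivity) (div_pos (by linarith) (by linarith))
  obtain ⟨v, hv⟩ : ∃ v : ℝ≥0, (v : ℝ) = τ ^ 2 * (n / (n - 2)) := ⟨⟨_, hv0.le⟩, rfl⟩
  rw [predictiveDensity_group hτ _ _ (fun j : {j : ι // j ≠ i} => x j) (x i) (fun j => hx j) (hx i)
    (fun j => by simp [columns, interceptDesign])
    (by simp [columns, interceptDesign]) _ _ hN hpos (hN' ▸ by linarith) hS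
    (v := v), log_gaussianPDFReal _ (NNReal.coe_pos.1 (hv ▸ hv0))]
  · rw [hv]
    congr 1
    field_simp
    ring
  · rw [hv]
    field_simp
    ring

lemma sum_const_sub_mul (a b : ℝ) (f : ι → ℝ) :
    ∑ i, (a - b * f i) = Fintype.card ι * a - b * ∑ i, f i := by
  rw [Finset.sum_sub_distrib, ← Finset.mul_sum, Finset.sum_const, Finset.card_univ, nsmul_eq_mul]

/-- The leave-one-out estimate of the difference in closed form. -/
lemma looDiff_eq [DecidableEq ι] {τ : ℝ≥0} (hτ : 0 < τ) (x y : ι → ℝ)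
    (hx : ∀ i, x i = 1 ∨ x i = -1) (hbal : ∑ i, x i = 0)
    (hn : 4 ≤ Fintype.card ι) {n : ℝ} (hnc : (Fintype.card ι : ℝ) = n) :
    looDiff τ (interceptDesign x) {0} {0, 1} y =
      n / 2 * Real.log ((n - 1) / (n - 2)) + 1 / (2 * τ ^ 2) *
        (n / (n - 2) * ∑ i, (y i - mean y - x i * slope x y) ^ 2 -
          n / (n - 1) * ∑ i, (y i - mean y) ^ 2) := by
  have hτ' : (0 : ℝ) < τ := hτ
  have hn4 : (4 : ℝ) ≤ n := by rw [← hnc]; exact_mod_cast hn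
  rw [looDiff, elpdLOO_intercept hτ x y hn hnc, elpdLOO_group hτ x y hx hbal hn hnc, sum_const_sub_mul,
    sum_const_sub_mul, hnc]
  have h1 : 0 < n - 1 := by linarith
  have h2 : 0 < n - 2 := by linarith
  have h0 : 0 < n := by linarith
  have e : Real.log (2 * Real.pi * (τ ^ 2 * (n / (n - 2)))) =
      Real.log (2 * Real.pi * (τ ^ 2 * (n / (n - 1)))) + Real.log ((n - 1) / (n - 2)) := by
    rw [← Real.log_mul (by positivity) (by positivity)]
    congr 1
    field_simp
  rw [e]
  generalize ∑ i, (y i - mean y) ^ 2 = A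
  generalize ∑ i, (y i - mean y - x i * slope x y) ^ 2 = B
  field_simp
  ring

lemma integral_sub_sq_gaussianReal (μ c : ℝ) (v : ℝ≥0) :
    Integrable (fun t => (t - c) ^ 2) (gaussianReal μ v) ∧
      ∫ t, (t - c) ^ 2 ∂gaussianReal μ v = v + (μ - c) ^ 2 := by
  have h : MemLp (fun t : ℝ => t - c) 2 (gaussianReal μ v) :=
    (memLp_id_gaussianReal 2).sub (memLp_const c)
  have h1 : Integrable (fun t : ℝ => t) (gaussianReal μ v) :=
    (memLp_id_gaussianReal 1).integrable le_rfl
  refine ⟨h.integrable_sq, ?_⟩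
  have h2 := variance_eq_sub h
  have h3 : Var[fun t : ℝ => t - c; gaussianReal μ v] = v := by
    rw [variance_sub_const (by fun_prop), variance_fun_id_gaussianReal]
  have h4 : ∫ t : ℝ, t - c ∂gaussianReal μ v = μ - c := by
    rw [integral_sub h1 (integrable_const c), integral_id_gaussianReal]
    simp
  rw [h3, h4] at h2
  simp only [Pi.pow_apply] at h2
  linarith

lemma integral_log_gaussianPDFReal {κ : Type*} {P : Measure (κ → ℝ)} (i : κ) {a c : ℝ} {w v : ℝ≥0}
    (hP : P.map (fun y => y i) = gaussianReal a w) (hv : 0 < v) :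
    ∫ y, Real.log (gaussianPDFReal c v (y i)) ∂P =
      -(1 / 2) * Real.log (2 * Real.pi * v) - (w + (a - c) ^ 2) / (2 * v) := by
  have h := integral_sub_sq_gaussianReal a c w
  have h' := integral_map (μ := P) (φ := fun y => y i)
    (measurable_pi_apply i).aemeasurable
    (f := fun t => Real.log (gaussianPDFReal c v t))
    ((measurable_gaussianPDFReal c v).log.aestronglyMeasurable)
  rw [← h', hP]
  simp_rw [log_gaussianPDFReal c hv]
  rw [integral_sub (integrable_const _) (h.1.div_const _), integral_div, h.2]
  simp

/-- The elpd difference in closed form. -/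
lemma elpdDiff_eq {P : Measure (ι → ℝ)} {τ s : ℝ≥0} (hτ : 0 < τ) (x y ν : ι → ℝ)
    (hP : ∀ i, P.map (fun y => y i) = gaussianReal (ν i) (s ^ 2))
    (hx : ∀ i, x i = 1 ∨ x i = -1) (hbal : ∑ i, x i = 0)
    (hn : 4 ≤ Fintype.card ι) {n : ℝ} (hnc : (Fintype.card ι : ℝ) = n) :
    elpdDiff P τ (interceptDesign x) {0} {0, 1} y =
      n / 2 * Real.log ((n + 2) / (n + 1)) + 1 / (2 * τ ^ 2) *
        (n / (n + 2) * (n * s ^ 2 + ∑ i, (ν i - mean y - x i * slope x y) ^ 2) -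
          n / (n + 1) * (n * s ^ 2 + ∑ i, (ν i - mean y) ^ 2)) := by
  have hτ' : (0 : ℝ) < τ := hτ
  have hn4 : (4 : ℝ) ≤ n := by rw [← hnc]; exact_mod_cast hn
  have h0 : 0 < n := by linarith
  have : Nonempty ι := by
    rw [← Fintype.card_pos_iff]
    omega
  have ha : elpd P τ (columns (interceptDesign x) {0}) y =
      ∑ i, (-(1 / 2) * Real.log (2 * Real.pi * (τ ^ 2 * ((n + 1) / n))) -
        n / (n + 1) / (2 * τ ^ 2) * (s ^ 2 + (ν i - mean y) ^ 2)) := by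
    refine Finset.sum_congr rfl fun i _ => ?_
    simp_rw [predictiveDensity_intercept hτ (columns (interceptDesign x) {0})
      (columns (interceptDesign x) {0} i) (fun j => by simp [columns, interceptDesign])
      (by simp [columns, interceptDesign]) y]
    rw [integral_log_gaussianPDFReal i (hP i) (by positivity), ← mean]
    push_cast
    rw [hnc]
    have e : (τ : ℝ) ^ 2 + τ ^ 2 / n = τ ^ 2 * ((n + 1) / n) := by
      field_simp
    rw [e]
    congr 1
    field_simp
  have hb : elpd P τ (columns (interceptDesign x) {0, 1}) y =
      ∑ i, (-(1 / 2) * Real.log (2 * Real.pi * (τ ^ 2 * ((n + 2) / n))) -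
        n / (n + 2) / (2 * τ ^ 2) * (s ^ 2 + (ν i - mean y - x i * slope x y) ^ 2)) := by
    refine Finset.sum_congr rfl fun i _ => ?_
    have hN : ∑ j, (1 + x i * x j) / 2 = n / 2 := by
      rw [← Finset.sum_div, Finset.sum_add_distrib, ← Finset.mul_sum, hbal]
      simp [hnc]
    have hN' : ∑ j, (1 - x i * x j) / 2 = n / 2 := by
      rw [← Finset.sum_div, Finset.sum_sub_distrib, ← Finset.mul_sum, hbal]
      simp [hnc]
    have hS : ∑ j, (1 + x i * x j) / 2 * y j = n / 2 * (mean y + x i * slope x y) := by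
      rw [mean, slope, hnc]
      have : ∀ j, (1 + x i * x j) / 2 * y j = y j / 2 + x i / 2 * (x j * y j) := fun j => by ring
      rw [Finset.sum_congr rfl fun j _ => this j, Finset.sum_add_distrib, ← Finset.sum_div,
        ← Finset.mul_sum]
      field_simp
    have hv0 : 0 < (τ : ℝ) ^ 2 * ((n + 2) / n) := by positivity
    obtain ⟨v, hv⟩ : ∃ v : ℝ≥0, (v : ℝ) = τ ^ 2 * ((n + 2) / n) := ⟨⟨_, hv0.le⟩, rfl⟩
    have hpos : 0 < n / 2 := by positivity
    have e : ∀ t, predictiveDensity τ (columns (interceptDesign x) {0, 1}) y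
        (columns (interceptDesign x) {0, 1} i) t =
          gaussianPDFReal (n / 2 * (mean y + x i * slope x y) / (n / 2)) v t := fun t =>
      predictiveDensity_group hτ (columns (interceptDesign x) {0, 1})
        (columns (interceptDesign x) {0, 1} i) x (x i) hx (hx i)
        (fun j => by simp [columns, interceptDesign])
        (by simp [columns, interceptDesign]) y t hN hpos (hN' ▸ hpos) hS
        (by rw [hv]; field_simp)
    simp only [e]
    rw [integral_log_gaussianPDFReal i (hP i) (NNReal.coe_pos.1 (hv ▸ hv0)), hv]
    push_cast
    congr 1
    field_simp
    ring
  rw [elpdDiff, ha, hb, sum_const_sub_mul, sum_const_sub_mul, Finset.sum_add_distrib,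
    Finset.sum_add_distrib, Finset.sum_const, Finset.card_univ, nsmul_eq_mul, hnc]
  have e : Real.log (2 * Real.pi * (τ ^ 2 * ((n + 2) / n))) =
      Real.log (2 * Real.pi * (τ ^ 2 * ((n + 1) / n))) + Real.log ((n + 2) / (n + 1)) := by
    rw [← Real.log_mul (by positivity) (by positivity)]
    congr 1
    field_simp
  rw [e]
  generalize ∑ i, (ν i - mean y) ^ 2 = A
  generalize ∑ i, (ν i - mean y - x i * slope x y) ^ 2 = B
  field_simp
  ring

end ClosedForms

/-! ### Moments of the standard Gaussian up to order six -/

section GaussianMoments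

lemma integrable_pow_of_memLp {Ω : Type*} [MeasurableSpace Ω] {P : Measure Ω}
    [IsProbabilityMeasure P] {f : Ω → ℝ} {p : ℕ} (hf : MemLp f p P) {j : ℕ} (hj : j ≤ p) :
    Integrable (fun ω => f ω ^ j) P := by
  have h : Integrable (fun ω => ‖f ω‖ ^ j) P :=
    (hf.mono_exponent (by exact_mod_cast hj)).integrable_norm_pow'
  refine (integrable_norm_iff (hf.1.pow j)).1 ?_
  simpa using h

lemma integral_pow_gaussianReal (j : ℕ) :
    ∫ t, t ^ j ∂gaussianReal 0 1 =
      iteratedDeriv j (fun t : ℝ => Real.exp (t ^ 2 / 2)) 0 := by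
  have h := iteratedDeriv_mgf_zero (X := id) (μ := gaussianReal 0 1)
    (by rw [integrableExpSet_id_gaussianReal]; simp) j
  rw [mgf_id_gaussianReal] at h
  simpa using h.symm

open Polynomial in
-- By `integral_pow_gaussianReal` the moments are derivatives of `exp (t ^ 2 / 2)` at zero. Each
-- derivative is a polynomial times the exponential, and the next polynomial is `p' + X * p`; its
-- constant term is the moment.
lemma iteratedDeriv_mul_exp (j : ℕ) {p q : ℝ[X]}
    (h : iteratedDeriv j (fun t : ℝ => Real.exp (t ^ 2 / 2)) =
      fun t => p.eval t * Real.exp (t ^ 2 / 2)) (hq : derivative p + X * p = q) :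
    iteratedDeriv (j + 1) (fun t : ℝ => Real.exp (t ^ 2 / 2)) =
      fun t => q.eval t * Real.exp (t ^ 2 / 2) := by
  rw [iteratedDeriv_succ, h]
  funext t
  have h1 : HasDerivAt (fun t : ℝ => Real.exp (t ^ 2 / 2)) (Real.exp (t ^ 2 / 2) * t) t := by
    convert! ((hasDerivAt_pow 2 t).div_const 2).exp using 1
    simp
  have h2 : HasDerivAt (fun t => p.eval t * Real.exp (t ^ 2 / 2)) _ t := (p.hasDerivAt t).mul h1
  rw [h2.deriv, ← hq]
  simp
  ring

open Polynomial in
lemma moments_gaussianReal :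
    (∫ t, t ∂gaussianReal 0 1) = 0 ∧ (∫ t, t ^ 2 ∂gaussianReal 0 1) = 1 ∧
    (∫ t, t ^ 3 ∂gaussianReal 0 1) = 0 ∧ (∫ t, t ^ 4 ∂gaussianReal 0 1) = 3 ∧
    (∫ t, t ^ 5 ∂gaussianReal 0 1) = 0 ∧ (∫ t, t ^ 6 ∂gaussianReal 0 1) = 15 := by
  have h0 : iteratedDeriv 0 (fun t : ℝ => Real.exp (t ^ 2 / 2)) =
      fun t => (1 : ℝ[X]).eval t * Real.exp (t ^ 2 / 2) := by simp
  have h1 := iteratedDeriv_mul_exp 0 h0 (q := X) (by simp)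
  have h2 := iteratedDeriv_mul_exp 1 h1 (q := X ^ 2 + 1) (by simp; ring)
  have h3 := iteratedDeriv_mul_exp 2 h2 (q := X ^ 3 + 3 * X) (by simp; ring)
  have h4 := iteratedDeriv_mul_exp 3 h3 (q := X ^ 4 + 6 * X ^ 2 + 3) (by simp [map_ofNat]; ring)
  have h5 := iteratedDeriv_mul_exp 4 h4 (q := X ^ 5 + 10 * X ^ 3 + 15 * X) (by simp [map_ofNat]; ring)
  have h6 := iteratedDeriv_mul_exp 5 h5 (q := X ^ 6 + 15 * X ^ 4 + 45 * X ^ 2 + 15)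
    (by simp [map_ofNat]; ring)
  refine ⟨integral_id_gaussianReal, ?_, ?_, ?_, ?_, ?_⟩
  · rw [integral_pow_gaussianReal, h2]; simp
  · rw [integral_pow_gaussianReal, h3]; simp
  · rw [integral_pow_gaussianReal, h4]; simp
  · rw [integral_pow_gaussianReal, h5]; simp
  · rw [integral_pow_gaussianReal, h6]; simp

lemma integrable_pow_gaussianReal (j : ℕ) :
    Integrable (fun t : ℝ => t ^ j) (gaussianReal 0 1) :=
  integrable_pow_of_memLp (f := id) (p := j) (memLp_id_gaussianReal j) le_rfl

lemma memLp_sq_sub_one_gaussianReal :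
    MemLp (fun t : ℝ => t ^ 2 - 1) 4 (gaussianReal 0 1) := by
  refine MemLp.sub ?_ (memLp_const 1)
  have h : MemLp (fun t : ℝ => t) 8 (gaussianReal 0 1) := memLp_id_gaussianReal 8
  refine (integrable_norm_rpow_iff (by fun_prop) (by norm_num) (by norm_num)).1 ?_
  refine (integrable_pow_gaussianReal 8).congr (.of_forall fun t => ?_)
  simp only [ENNReal.toReal_ofNat, norm_pow, Real.norm_eq_abs, sq_abs]
  rw [show (4 : ℝ) = ((4 : ℕ) : ℝ) by norm_num, Real.rpow_natCast]
  ring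

lemma integral_sum_pow_gaussianReal (c : Fin 7 → ℝ) :
    ∫ t, ∑ j, c j * t ^ (j : ℕ) ∂gaussianReal 0 1 = c 0 + c 2 + 3 * c 4 + 15 * c 6 := by
  obtain ⟨m1, m2, m3, m4, m5, m6⟩ := moments_gaussianReal
  rw [integral_finsetSum _ fun (j : Fin 7) _ =>
    (integrable_pow_gaussianReal (j : ℕ)).const_mul (c j)]
  simp_rw [integral_const_mul]
  simp [Fin.sum_univ_succ, m1, m2, m3, m4, m5, m6, Fin.succ]
  ring

/-- Second and third moments of a quadratic polynomial in a standard Gaussian variable. -/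
lemma moments_quadratic_gaussianReal (a b : ℝ) :
    ∫ t, (a * t + b * (t ^ 2 - 1)) ^ 2 ∂gaussianReal 0 1 = a ^ 2 + 2 * b ^ 2 ∧
    ∫ t, (a * t + b * (t ^ 2 - 1)) ^ 3 ∂gaussianReal 0 1 = 8 * b ^ 3 + 6 * a ^ 2 * b := by
  constructor
  · have e : ∀ t : ℝ, (a * t + b * (t ^ 2 - 1)) ^ 2 =
        ∑ j, ![b ^ 2, -2 * a * b, a ^ 2 - 2 * b ^ 2, 2 * a * b, b ^ 2, 0, 0] j * t ^ (j : ℕ) :=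
      fun t => by
        simp [Fin.sum_univ_succ]
        ring
    simp_rw [e]
    rw [integral_sum_pow_gaussianReal]
    simp
    ring
  · have e : ∀ t : ℝ, (a * t + b * (t ^ 2 - 1)) ^ 3 =
        ∑ j, ![-b ^ 3, 3 * a * b ^ 2, 3 * b ^ 3 - 3 * a ^ 2 * b, a ^ 3 - 6 * a * b ^ 2,
          3 * a ^ 2 * b - 3 * b ^ 3, 3 * a * b ^ 2, b ^ 3] j * t ^ (j : ℕ) :=
      fun t => by
        simp [Fin.sum_univ_succ]
        ring
    simp_rw [e]
    rw [integral_sum_pow_gaussianReal]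
    simp
    ring

end GaussianMoments

/-! ### Sums of independent variables -/

section IndependentSums

variable {Ω ι : Type*} [MeasurableSpace Ω] {P : Measure Ω} [IsProbabilityMeasure P]

/-- The fourth moment of a sum of independent centred variables grows at most quadratically. -/
lemma fourth_moment_sum_le {X : ι → Ω → ℝ} (hX : iIndepFun X P) (hm : ∀ i, Measurable (X i))
    (h4 : ∀ i, MemLp (X i) 4 P) (h0 : ∀ i, ∫ ω, X i ω ∂P = 0) {a b : ℝ}
    (ha : ∀ i, ∫ ω, X i ω ^ 2 ∂P = a) (hb : ∀ i, ∫ ω, X i ω ^ 4 ∂P = b) (s : Finset ι) :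
    (∫ ω, (∑ i ∈ s, X i ω) ∂P = 0) ∧ (∫ ω, (∑ i ∈ s, X i ω) ^ 2 ∂P = a * s.card) ∧
      ∫ ω, (∑ i ∈ s, X i ω) ^ 4 ∂P ≤ (3 * a ^ 2 + b) * s.card ^ 2 := by
  classical
  induction s using Finset.induction_on with
  | empty => simp
  | insert i s hi ih =>
    obtain ⟨ih1, ih2, ih4⟩ := ih
    have hS4 : MemLp (fun ω => ∑ j ∈ s, X j ω) ((4 : ℕ) : ENNReal) P := by
      exact_mod_cast memLp_finsetSum s fun j _ => h4 j
    have hX4 : MemLp (X i) ((4 : ℕ) : ENNReal) P := by exact_mod_cast h4 i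
    have hind : IndepFun (fun ω => ∑ j ∈ s, X j ω) (X i) P := by
      have := hX.indepFun_finsetSum_of_notMem hm hi
      rwa [show (∑ j ∈ s, X j) = fun ω => ∑ j ∈ s, X j ω by ext; simp] at this
    have hSm : Measurable fun ω => ∑ j ∈ s, X j ω := by fun_prop
    set S : Ω → ℝ := fun ω => ∑ j ∈ s, X j ω with hS
    have iS : ∀ k ≤ 4, Integrable (fun ω => S ω ^ k) P := fun k hk => integrable_pow_of_memLp hS4 hk
    have iX : ∀ k ≤ 4, Integrable (fun ω => X i ω ^ k) P :=
      fun k hk => integrable_pow_of_memLp hX4 hk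
    have hindp : ∀ k l : ℕ, IndepFun (fun ω => S ω ^ k) (fun ω => X i ω ^ l) P := fun k l =>
      hind.comp (φ := fun t => t ^ k) (ψ := fun t => t ^ l) (by fun_prop) (by fun_prop)
    have iSX : ∀ k ≤ 4, ∀ l ≤ 4, Integrable (fun ω => S ω ^ k * X i ω ^ l) P :=
      fun k hk l hl => (hindp k l).integrable_mul (iS k hk) (iX l hl)
    have mSX : ∀ k ≤ 4, ∀ l ≤ 4, ∫ ω, S ω ^ k * X i ω ^ l ∂P =
        (∫ ω, S ω ^ k ∂P) * ∫ ω, X i ω ^ l ∂P := fun k hk l hl =>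
      (hindp k l).integral_fun_mul_eq_mul_integral (iS k hk).1 (iX l hl).1
    have m0 : ∫ ω, X i ω ^ 1 ∂P = 0 := by simpa using h0 i
    have mS : ∫ ω, S ω ^ 1 ∂P = 0 := by simpa using ih1
    have hcard : ((insert i s).card : ℝ) = s.card + 1 := by
      rw [Finset.card_insert_of_notMem hi]; push_cast; rfl
    have hsum : ∀ ω, ∑ j ∈ insert i s, X j ω = S ω + X i ω := fun ω => by
      rw [Finset.sum_insert hi, add_comm]
    simp_rw [hsum, hcard]
    refine ⟨?_, ?_, ?_⟩
    · have iS1 : Integrable S P := by simpa using iS 1 (by norm_num)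
      have iX1 : Integrable (X i) P := by simpa using iX 1 (by norm_num)
      rw [integral_add iS1 iX1, h0, ih1, add_zero]
    · have e : ∀ ω, (S ω + X i ω) ^ 2 =
          S ω ^ 2 + (2 * (S ω ^ 1 * X i ω ^ 1) + X i ω ^ 2) := fun ω => by ring
      have j1 := (iSX 1 (by norm_num) 1 (by norm_num)).const_mul 2
      have j1' : Integrable (fun ω => 2 * (S ω ^ 1 * X i ω ^ 1) + X i ω ^ 2) P :=
        j1.add (iX 2 (by norm_num))
      simp_rw [e]
      rw [integral_add (iS 2 (by norm_num)) j1',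
        integral_add j1 (iX 2 (by norm_num)), integral_const_mul,
        mSX 1 (by norm_num) 1 (by norm_num), ih2, ha, m0]
      ring
    · have e : ∀ ω, (S ω + X i ω) ^ 4 =
          S ω ^ 4 + (4 * (S ω ^ 3 * X i ω ^ 1) + (6 * (S ω ^ 2 * X i ω ^ 2) +
            (4 * (S ω ^ 1 * X i ω ^ 3) + X i ω ^ 4))) := fun ω => by ring
      have j3 := (iSX 3 (by norm_num) 1 (by norm_num)).const_mul 4
      have j2 := (iSX 2 (by norm_num) 2 (by norm_num)).const_mul 6
      have j1 := (iSX 1 (by norm_num) 3 (by norm_num)).const_mul 4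
      have j0 := iX 4 le_rfl
      have k1 : Integrable (fun ω => 4 * (S ω ^ 1 * X i ω ^ 3) + X i ω ^ 4) P := j1.add j0
      have k2 : Integrable (fun ω => 6 * (S ω ^ 2 * X i ω ^ 2) +
        (4 * (S ω ^ 1 * X i ω ^ 3) + X i ω ^ 4)) P := j2.add k1
      have k3 : Integrable (fun ω => 4 * (S ω ^ 3 * X i ω ^ 1) + (6 * (S ω ^ 2 * X i ω ^ 2) +
        (4 * (S ω ^ 1 * X i ω ^ 3) + X i ω ^ 4))) P := j3.add k2
      simp_rw [e]
      rw [integral_add (iS 4 le_rfl) k3, integral_add j3 k2, integral_add j2 k1,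
        integral_add j1 j0,
        -- By independence and centring, the terms with an odd power of the new variable or of the
        -- old sum vanish.
        integral_const_mul, integral_const_mul, integral_const_mul,
        mSX 3 (by norm_num) 1 (by norm_num), mSX 2 (by norm_num) 2 (by norm_num),
        mSX 1 (by norm_num) 3 (by norm_num), m0, mS, ih2, ha, hb]
      have hb0 : 0 ≤ b := by
        rw [← hb i]
        exact integral_nonneg fun ω => by positivity
      have hc : (0 : ℝ) ≤ s.card := by positivity
      -- With `c = s.card`, the slack `(3 * a ^ 2 + b) * (2 * c + 1) - 6 * a ^ 2 * c - b` equals `3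
      -- * a ^ 2 + 2 * b * c`.
      nlinarith [mul_nonneg hb0 hc, sq_nonneg a]

/-- A linear combination of independent standard Gaussian variables is Gaussian. -/
lemma map_sum_mul_gaussianReal {X : ι → Ω → ℝ} (hX : iIndepFun X P)
    (hm : ∀ i, Measurable (X i)) (hl : ∀ i, P.map (X i) = gaussianReal 0 1) (a : ι → ℝ)
    (s : Finset ι) {v : ℝ≥0} (hv : (v : ℝ) = ∑ i ∈ s, a i ^ 2) :
    P.map (fun ω => ∑ i ∈ s, a i * X i ω) = gaussianReal 0 v := by
  classical
  induction s using Finset.induction_on generalizing v with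
  | empty =>
    obtain rfl : v = 0 := NNReal.coe_injective (by simpa using hv)
    simp
  | insert i s hi ih =>
    obtain ⟨w, hw⟩ : ∃ w : ℝ≥0, (w : ℝ) = ∑ i ∈ s, a i ^ 2 :=
      ⟨⟨_, Finset.sum_nonneg fun i _ => sq_nonneg (a i)⟩, rfl⟩
    obtain ⟨u, hu⟩ : ∃ u : ℝ≥0, (u : ℝ) = a i ^ 2 := ⟨⟨_, sq_nonneg (a i)⟩, rfl⟩
    have hind : IndepFun (fun ω => ∑ j ∈ s, a j * X j ω) (fun ω => a i * X i ω) P := by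
      have := (hX.comp (fun j t => a j * t) fun j => by fun_prop).indepFun_finsetSum_of_notMem
        (fun j => by fun_prop) hi
      rwa [show (∑ j ∈ s, (fun t => a j * t) ∘ X j) = fun ω => ∑ j ∈ s, a j * X j ω by
        ext; simp] at this
    have hi' : P.map (fun ω => a i * X i ω) = gaussianReal 0 u := by
      have := Measure.map_map (μ := P) (f := X i) (g := fun t => a i * t) (by fun_prop) (hm i)
      rw [hl, gaussianReal_map_const_mul] at this
      rw [show (fun ω => a i * X i ω) = (fun t => a i * t) ∘ X i from rfl, ← this, mul_zero,
        mul_one]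
      congr 1
      exact NNReal.coe_injective hu.symm
    have h := gaussianReal_add_gaussianReal_of_indepFun hind (ih hw) hi'
    rw [show (fun ω => ∑ j ∈ insert i s, a j * X j ω) =
      (fun ω => ∑ j ∈ s, a j * X j ω) + fun ω => a i * X i ω by
        ext ω; rw [Finset.sum_insert hi, add_comm]; rfl, h, add_zero]
    congr 1
    apply NNReal.coe_injective
    rw [hv, Finset.sum_insert hi, NNReal.coe_add, hw, hu, add_comm]

end IndependentSums

/-! ### Stability of moments under convergence of coefficients -/

section MomentConvergence

/-- If the coefficients of linear combinations of variables with bounded fourth moments converge,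
then replacing them by their limits does not affect moments up to order four in the limit. -/
lemma tendsto_integral_pow_sub {J : Type*} [Fintype J] {Ω : ℕ → Type*}
    [∀ k, MeasurableSpace (Ω k)] {P : (k : ℕ) → Measure (Ω k)} [∀ k, IsProbabilityMeasure (P k)]
    {Y : (k : ℕ) → J → Ω k → ℝ} {K : ℝ} (hY : ∀ k j, MemLp (Y k j) 4 (P k))
    (hK : ∀ k j, ∫ ω, Y k j ω ^ 4 ∂P k ≤ K) {c : ℕ → J → ℝ} {C : J → ℝ}
    (hc : ∀ j, Tendsto (fun k => c k j) atTop (𝓝 (C j))) {p : ℕ} (hp : p ≤ 4) :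
    Tendsto (fun k => ∫ ω, (∑ j, c k j * Y k j ω) ^ p ∂P k - ∫ ω, (∑ j, C j * Y k j ω) ^ p ∂P k)
      atTop (𝓝 0) := by
  rcases Nat.eq_zero_or_pos p with rfl | hp0
  · simp
  set δ : ℕ → ℝ := fun k => ∑ j, |c k j - C j| with hδ
  set A : ℝ := ∑ j, |C j| with hA
  set S : (k : ℕ) → Ω k → ℝ := fun k ω => ∑ j, |Y k j ω| with hS
  have hS0 : ∀ k ω, 0 ≤ S k ω := fun k ω => Finset.sum_nonneg fun j _ => abs_nonneg _
  have hA0 : 0 ≤ A := Finset.sum_nonneg fun j _ => abs_nonneg _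
  have hδ0 : ∀ k, 0 ≤ δ k := fun k => Finset.sum_nonneg fun j _ => abs_nonneg _
  have hδt : Tendsto δ atTop (𝓝 0) := by
    have h : Tendsto δ atTop (𝓝 (∑ j : J, |C j - C j|)) :=
      tendsto_finsetSum _ fun j _ => ((hc j).sub_const _).abs
    simpa using h
  have hY' : ∀ k j, MemLp (Y k j) ((4 : ℕ) : ENNReal) (P k) := fun k j => by
    exact_mod_cast hY k j
  have hSp : ∀ k, MemLp (S k) ((4 : ℕ) : ENNReal) (P k) := fun k =>
    memLp_finsetSum _ fun j _ => (hY' k j).abs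
  have hlin : ∀ (d : J → ℝ) (k : ℕ), MemLp (fun ω => ∑ j, d j * Y k j ω) ((4 : ℕ) : ENNReal) (P k) :=
    fun d k => memLp_finsetSum _ fun j _ => (hY' k j).const_mul (d j)
  have hbound : ∀ (d : J → ℝ) (k : ℕ) (ω : Ω k), |∑ j, d j * Y k j ω| ≤ (∑ j, |d j|) * S k ω := by
    intro d k ω
    rw [Finset.sum_mul]
    refine (Finset.abs_sum_le_sum_abs _ _).trans (Finset.sum_le_sum fun j _ => ?_)
    rw [abs_mul]
    exact mul_le_mul_of_nonneg_left
      (Finset.single_le_sum (f := fun j => |Y k j ω|) (fun j _ => abs_nonneg _)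
        (Finset.mem_univ j)) (abs_nonneg _)
  -- This bounds the `p`-th moment of `S k`: use `S ^ p ≤ 1 + S ^ 4` and the power mean inequality
  -- for `S ^ 4`.
  set M : ℝ := 1 + (Fintype.card J : ℝ) ^ 3 * (Fintype.card J * K) with hM
  have hSint : ∀ k, ∫ ω, S k ω ^ p ∂P k ≤ M := by
    intro k
    have i4 : ∀ j, Integrable (fun ω => Y k j ω ^ 4) (P k) :=
      fun j => integrable_pow_of_memLp (hY' k j) le_rfl
    have h1 : ∀ ω, S k ω ^ p ≤ 1 + (Fintype.card J : ℝ) ^ 3 * ∑ j, Y k j ω ^ 4 := by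
      intro ω
      have h2 : S k ω ^ 4 ≤ (Fintype.card J : ℝ) ^ 3 * ∑ j, Y k j ω ^ 4 := by
        rcases isEmpty_or_nonempty J with hJ | hJ
        · simp [hS]
        · have := pow_sum_div_card_le_sum_pow (s := Finset.univ) (f := fun j => |Y k j ω|)
            (fun j _ => abs_nonneg _) 3
          have hJc : (0 : ℝ) < Fintype.card J := by exact_mod_cast Fintype.card_pos
          rw [Finset.card_univ, div_le_iff₀ (by positivity), mul_comm] at this
          simpa [hS, (by decide : Even 4).pow_abs] using this
      have h3 : S k ω ^ p ≤ 1 + S k ω ^ 4 := by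
        rcases le_total (S k ω) 1 with h | h
        · have := pow_le_one₀ (n := p) (hS0 k ω) h
          have := pow_nonneg (hS0 k ω) 4
          linarith
        · have := pow_le_pow_right₀ h hp
          linarith
      linarith
    have i4' : Integrable (fun ω => 1 + (Fintype.card J : ℝ) ^ 3 * ∑ j, Y k j ω ^ 4) (P k) :=
      (integrable_const 1).add ((integrable_finsetSum _ fun j _ => i4 j).const_mul _)
    refine (integral_mono (integrable_pow_of_memLp (hSp k) hp) i4' h1).trans ?_
    rw [integral_add (integrable_const 1) ((integrable_finsetSum _ fun j _ => i4 j).const_mul _),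
      integral_const_mul, integral_finsetSum _ fun j _ => i4 j]
    have : ∑ j, ∫ ω, Y k j ω ^ 4 ∂P k ≤ Fintype.card J * K := by
      refine (Finset.sum_le_card_nsmul _ _ K fun j _ => hK k j).trans ?_
      rw [Finset.card_univ, nsmul_eq_mul]
    simp only [integral_const, probReal_univ, smul_eq_mul, one_mul, hM]
    gcongr
  have hmain : ∀ k, |∫ ω, (∑ j, c k j * Y k j ω) ^ p ∂P k - ∫ ω, (∑ j, C j * Y k j ω) ^ p ∂P k| ≤
      δ k * p * (A + δ k) ^ (p - 1) * M := by
    intro k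
    rw [← integral_sub (integrable_pow_of_memLp (hlin _ k) hp)
      (integrable_pow_of_memLp (hlin _ k) hp)]
    refine abs_integral_le_integral_abs.trans ?_
    -- Pointwise, `|u ^ p - v ^ p| ≤ |u - v| * p * max |u| |v| ^ (p - 1)`. Here `|u - v|` is at most
    -- `δ k * S k`, and `|u|`, `|v|` are at most `(A + δ k) * S k`.
    have hpt : ∀ ω, |(∑ j, c k j * Y k j ω) ^ p - (∑ j, C j * Y k j ω) ^ p| ≤
        δ k * p * (A + δ k) ^ (p - 1) * S k ω ^ p := by
      intro ω
      refine (abs_pow_sub_pow_le _ _ _).trans ?_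
      have h1 : |∑ j, c k j * Y k j ω - ∑ j, C j * Y k j ω| ≤ δ k * S k ω := by
        have := hbound (fun j => c k j - C j) k ω
        simpa only [sub_mul, Finset.sum_sub_distrib] using this
      have h2 : |∑ j, C j * Y k j ω| ≤ A * S k ω := hbound C k ω
      have h3 : |∑ j, c k j * Y k j ω| ≤ (A + δ k) * S k ω := by
        have := abs_sub_abs_le_abs_sub (∑ j, c k j * Y k j ω) (∑ j, C j * Y k j ω)
        linarith
      have h4 : max |∑ j, c k j * Y k j ω| |∑ j, C j * Y k j ω| ≤ (A + δ k) * S k ω :=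
        max_le h3 (h2.trans (by nlinarith [hδ0 k, hS0 k ω, mul_nonneg (hδ0 k) (hS0 k ω)]))
      have h5 : S k ω ^ p = S k ω * S k ω ^ (p - 1) := by
        rw [← pow_succ', Nat.sub_add_cancel hp0]
      calc _ ≤ δ k * S k ω * p * ((A + δ k) * S k ω) ^ (p - 1) := by
            gcongr
        _ = _ := by rw [mul_pow, h5]; ring
    have iSp := (integrable_pow_of_memLp (hSp k) hp).const_mul (δ k * p * (A + δ k) ^ (p - 1))
    refine (integral_mono ((integrable_pow_of_memLp (hlin _ k) hp).sub
      (integrable_pow_of_memLp (hlin _ k) hp)).abs iSp hpt).trans ?_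
    rw [integral_const_mul]
    have := hδ0 k
    exact mul_le_mul_of_nonneg_left (hSint k) (by positivity)
  refine squeeze_zero_norm hmain ?_
  have : Tendsto (fun k => δ k * p * (A + δ k) ^ (p - 1) * M) atTop
      (𝓝 (0 * p * (A + 0) ^ (p - 1) * M)) :=
    ((hδt.mul_const _).mul ((hδt.const_add A).pow _)).mul_const M
  simpa using this

end MomentConvergence

/-! ### The six noise terms and their moments -/

section StandardizedNoise

variable {ι : Type*} [Fintype ι]

/-- The law of a vector of independent standard Gaussian variables. -/
noncomputable abbrev stdNormal (ι : Type*) [Fintype ι] : Measure (ι → ℝ) :=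
  Measure.pi fun _ => gaussianReal 0 1

/-- Makes a continuous function that vanishes almost surely vanish everywhere, which is how the
variances are shown to be positive. -/
instance : (gaussianReal 0 1).IsOpenPosMeasure :=
  (gaussianReal_absolutelyContinuous' 0 one_ne_zero).isOpenPosMeasure

/-- Centred functions of the standardized noise in terms of which the elpd differences are linear.
With `q = 1 / √n`, the vectors `q x` and `(q, …, q)` have norm one. -/
noncomputable def noiseTerm (x : ι → ℝ) (i₀ : ι) (q : ℝ) (j : Fin 6) (z : ι → ℝ) : ℝ :=
  ![∑ i, q * x i * z i, (∑ i, q * x i * z i) ^ 2 - 1, ∑ i, q * z i, (∑ i, q * z i) ^ 2 - 1, z i₀,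
    q * ∑ i, (z i ^ 2 - 1)] j

lemma continuous_noiseTerm (x : ι → ℝ) (i₀ : ι) (q : ℝ) (j : Fin 6) :
    Continuous (noiseTerm x i₀ q j) := by
  unfold noiseTerm
  fin_cases j <;> simp <;> fun_prop

lemma map_eval_stdNormal (i : ι) : (stdNormal ι).map (fun z => z i) = gaussianReal 0 1 :=
  (measurePreserving_eval (fun _ : ι => gaussianReal 0 1) i).map_eq

lemma map_sum_mul_stdNormal (a : ι → ℝ) (ha : ∑ i, a i ^ 2 = 1) :
    (stdNormal ι).map (fun z => ∑ i, a i * z i) = gaussianReal 0 1 :=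
  map_sum_mul_gaussianReal (P := stdNormal ι) (X := fun i z => z i)
    (iIndepFun_pi (X := fun _ => id) fun _ => aemeasurable_id) (fun i => measurable_pi_apply i)
    map_eval_stdNormal a Finset.univ (by simp [ha])

lemma moments_of_map_eq {Ω : Type*} [MeasurableSpace Ω] {P : Measure Ω} {Z : Ω → ℝ}
    (hZ : Measurable Z) (hP : P.map Z = gaussianReal 0 1) {g : ℝ → ℝ} (hg : Continuous g)
    (hg4 : MemLp g 4 (gaussianReal 0 1)) (p : ℕ) :
    MemLp (fun ω => g (Z ω)) 4 P ∧
      ∫ ω, g (Z ω) ^ p ∂P = ∫ t, g t ^ p ∂gaussianReal 0 1 := by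
  constructor
  · rw [← hP] at hg4
    exact hg4.comp_of_map hZ.aemeasurable
  · rw [← hP, integral_map hZ.aemeasurable (by fun_prop)]

lemma integral_sq_sub_one_gaussianReal : ∫ t, (t ^ 2 - 1) ^ 1 ∂gaussianReal 0 1 = 0 := by
  simp_rw [pow_one]
  rw [integral_sub (integrable_pow_gaussianReal 2) (integrable_const 1),
    moments_gaussianReal.2.1]
  simp

/-- A bound for the fourth moments of all noise terms. -/
noncomputable def noiseBound : ℝ :=
  -- The leading `3` is the fourth Gaussian moment; the rest is the constant of
  -- `fourth_moment_sum_le` for the variables `z i ^ 2 - 1`.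
  3 + 3 * (∫ t, (t ^ 2 - 1) ^ 2 ∂gaussianReal 0 1) ^ 2 + ∫ t, (t ^ 2 - 1) ^ 4 ∂gaussianReal 0 1

/-- The linear terms are exactly standard Gaussian because their coefficient vectors have norm one.
For the last term the factor `n ^ 2` in the fourth moment of the sum is offset by `q ^ 4`, so the
bound does not depend on `n`. -/
lemma noiseTerm_moments (x : ι → ℝ) (hx : ∀ i, x i = 1 ∨ x i = -1) (i₀ : ι) {q : ℝ}
    (hq : q ^ 2 * Fintype.card ι = 1) (j : Fin 6) :
    MemLp (noiseTerm x i₀ q j) 4 (stdNormal ι) ∧ ∫ z, noiseTerm x i₀ q j z ∂stdNormal ι = 0 ∧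
      ∫ z, noiseTerm x i₀ q j z ^ 4 ∂stdNormal ι ≤ noiseBound := by
  have hW := map_sum_mul_stdNormal (fun i => q * x i) (by
    have : ∀ i, (q * x i) ^ 2 = q ^ 2 := fun i => by
      rcases hx i with h | h <;> rw [h] <;> ring
    simp_rw [this]
    rw [Finset.sum_const, Finset.card_univ, nsmul_eq_mul, mul_comm, hq])
  have hV := map_sum_mul_stdNormal (fun _ : ι => q) (by
    rw [Finset.sum_const, Finset.card_univ, nsmul_eq_mul, mul_comm, hq])
  have hU := map_eval_stdNormal i₀
  have hb0 : 0 ≤ ∫ t, (t ^ 2 - 1) ^ 4 ∂gaussianReal 0 1 :=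
    integral_nonneg fun t => by positivity
  have hlin : ∀ Z : (ι → ℝ) → ℝ, Measurable Z → (stdNormal ι).map Z = gaussianReal 0 1 →
      MemLp Z 4 (stdNormal ι) ∧ ∫ z, Z z ∂stdNormal ι = 0 ∧
        ∫ z, Z z ^ 4 ∂stdNormal ι ≤ noiseBound := by
    intro Z hZ h
    have h4 : MemLp (fun t : ℝ => t) 4 (gaussianReal 0 1) := memLp_id_gaussianReal 4
    obtain ⟨a, b⟩ := moments_of_map_eq hZ h continuous_id h4 1
    refine ⟨a, ?_, ?_⟩
    · simpa [moments_gaussianReal.1] using b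
    · have := (moments_of_map_eq hZ h continuous_id h4 4).2
      simp only [id] at this
      rw [this, moments_gaussianReal.2.2.2.1, noiseBound]
      nlinarith [sq_nonneg (∫ t, (t ^ 2 - 1) ^ 2 ∂gaussianReal 0 1)]
  have hquad : ∀ Z : (ι → ℝ) → ℝ, Measurable Z → (stdNormal ι).map Z = gaussianReal 0 1 →
      MemLp (fun z => Z z ^ 2 - 1) 4 (stdNormal ι) ∧ ∫ z, (Z z ^ 2 - 1) ∂stdNormal ι = 0 ∧
        ∫ z, (Z z ^ 2 - 1) ^ 4 ∂stdNormal ι = ∫ t, (t ^ 2 - 1) ^ 4 ∂gaussianReal 0 1 := by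
    intro Z hZ h
    have hc : Continuous fun t : ℝ => t ^ 2 - 1 := by fun_prop
    obtain ⟨a, b⟩ := moments_of_map_eq hZ h hc memLp_sq_sub_one_gaussianReal 1
    refine ⟨a, ?_, ?_⟩
    · rw [integral_sq_sub_one_gaussianReal] at b
      simpa using b
    · exact (moments_of_map_eq hZ h hc memLp_sq_sub_one_gaussianReal 4).2
  have hle : ∫ t, (t ^ 2 - 1) ^ 4 ∂gaussianReal 0 1 ≤ noiseBound := by
    rw [noiseBound]
    nlinarith [sq_nonneg (∫ t, (t ^ 2 - 1) ^ 2 ∂gaussianReal 0 1)]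
  have hT := fourth_moment_sum_le (P := stdNormal ι) (X := fun i z => z i ^ 2 - 1)
    (iIndepFun_pi (X := fun _ t => t ^ 2 - 1) fun _ => by fun_prop) (fun i => by fun_prop)
    (fun i => (hquad _ (measurable_pi_apply i) (map_eval_stdNormal i)).1)
    (fun i => (hquad _ (measurable_pi_apply i) (map_eval_stdNormal i)).2.1)
    (fun i => (moments_of_map_eq (measurable_pi_apply i) (map_eval_stdNormal i)
      (g := fun t => t ^ 2 - 1) (by fun_prop) memLp_sq_sub_one_gaussianReal 2).2)
    (fun i => (hquad _ (measurable_pi_apply i) (map_eval_stdNormal i)).2.2) Finset.univ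
  have hT4 : MemLp (fun z : ι → ℝ => ∑ i, (z i ^ 2 - 1)) 4 (stdNormal ι) :=
    memLp_finsetSum _ fun i _ => (hquad _ (measurable_pi_apply i) (map_eval_stdNormal i)).1
  fin_cases j
  · exact hlin (fun z => ∑ i, q * x i * z i) (by fun_prop) hW
  · have := hquad _ (by fun_prop) hW
    exact ⟨this.1, this.2.1, this.2.2.trans_le hle⟩
  · exact hlin (fun z => ∑ i, q * z i) (by fun_prop) hV
  · have := hquad _ (by fun_prop) hV
    exact ⟨this.1, this.2.1, this.2.2.trans_le hle⟩
  · exact hlin (fun z => z i₀) (by fun_prop) hU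
  · refine ⟨hT4.const_mul q, ?_, ?_⟩
    · change ∫ z : ι → ℝ, q * ∑ i, (z i ^ 2 - 1) ∂stdNormal ι = 0
      rw [integral_const_mul, hT.1, mul_zero]
    · change ∫ z : ι → ℝ, (q * ∑ i, (z i ^ 2 - 1)) ^ 4 ∂stdNormal ι ≤ noiseBound
      simp_rw [mul_pow]
      rw [integral_const_mul]
      have h := mul_le_mul_of_nonneg_left hT.2.2 (by positivity : 0 ≤ q ^ 4)
      rw [Finset.card_univ] at h
      refine h.trans ?_
      have e : q ^ 4 * ((3 * (∫ t, (t ^ 2 - 1) ^ 2 ∂gaussianReal 0 1) ^ 2 +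
          ∫ t, (t ^ 2 - 1) ^ 4 ∂gaussianReal 0 1) * (Fintype.card ι : ℝ) ^ 2) =
          (q ^ 2 * Fintype.card ι) ^ 2 * (3 * (∫ t, (t ^ 2 - 1) ^ 2 ∂gaussianReal 0 1) ^ 2 +
          ∫ t, (t ^ 2 - 1) ^ 4 ∂gaussianReal 0 1) := by ring
      rw [e, hq, noiseBound]
      linarith

/-- The limiting moments: only the first two noise terms remain. -/
lemma integral_noise_limit (x : ι → ℝ) (hx : ∀ i, x i = 1 ∨ x i = -1) (i₀ : ι) {q : ℝ}
    (hq : q ^ 2 * Fintype.card ι = 1) (a b : ℝ) :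
    ∫ z, (∑ j, ![a, b, 0, 0, 0, 0] j * noiseTerm x i₀ q j z) ^ 2 ∂stdNormal ι =
        a ^ 2 + 2 * b ^ 2 ∧
      ∫ z, (∑ j, ![a, b, 0, 0, 0, 0] j * noiseTerm x i₀ q j z) ^ 3 ∂stdNormal ι =
        8 * b ^ 3 + 6 * a ^ 2 * b := by
  have hW := map_sum_mul_stdNormal (fun i => q * x i) (by
    have : ∀ i, (q * x i) ^ 2 = q ^ 2 := fun i => by
      rcases hx i with h | h <;> rw [h] <;> ring
    simp_rw [this]
    rw [Finset.sum_const, Finset.card_univ, nsmul_eq_mul, mul_comm, hq])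
  have h4 : MemLp (fun t : ℝ => a * t + b * (t ^ 2 - 1)) 4 (gaussianReal 0 1) :=
    ((memLp_id_gaussianReal 4).const_mul a).add (memLp_sq_sub_one_gaussianReal.const_mul b)
  have e : ∀ z, ∑ j, ![a, b, 0, 0, 0, 0] j * noiseTerm x i₀ q j z =
      a * (∑ i, q * x i * z i) + b * ((∑ i, q * x i * z i) ^ 2 - 1) := fun z => by
    simp [Fin.sum_univ_succ, noiseTerm]
  have hm := fun p => (moments_of_map_eq (by fun_prop) hW (g := fun t => a * t + b * (t ^ 2 - 1))
    (by fun_prop) h4 p).2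
  have hl := moments_quadratic_gaussianReal a b
  simp_rw [e]
  exact ⟨(hm 2).trans hl.1, (hm 3).trans hl.2⟩

/-- Mean, variance and third central moment of a function that is linear in the noise terms. -/
lemma moments_of_noise_expansion (x : ι → ℝ) (hx : ∀ i, x i = 1 ∨ x i = -1) (i₀ : ι) {q : ℝ}
    (hq : q ^ 2 * Fintype.card ι = 1) {P : Measure (ι → ℝ)} {ν : ι → ℝ} {s : ℝ≥0} (hs : 0 < s)
    (hP : P = (stdNormal ι).map fun z i => ν i + s * z i) {f : (ι → ℝ) → ℝ} {e : ℝ}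
    {c : Fin 6 → ℝ} (hf : ∀ z, f (fun i => ν i + s * z i) = e + ∑ j, c j * noiseTerm x i₀ q j z) :
    MemLp f 3 P ∧ ∫ y, f y ∂P = e ∧
      variance f P = ∫ z, (∑ j, c j * noiseTerm x i₀ q j z) ^ 2 ∂stdNormal ι ∧
      centralMoment f 3 P = ∫ z, (∑ j, c j * noiseTerm x i₀ q j z) ^ 3 ∂stdNormal ι := by
  have hs' : (s : ℝ) ≠ 0 := NNReal.coe_ne_zero.2 hs.ne'
  have hY := noiseTerm_moments x hx i₀ hq
  have hcY := continuous_noiseTerm x i₀ q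
  -- Since `s ≠ 0` the standardization can be inverted; this exhibits `f` as a continuous, hence
  -- measurable, function.
  have hf' : f = fun y => e + ∑ j, c j * noiseTerm x i₀ q j fun i => (y i - ν i) / s := by
    funext y
    rw [← hf]
    congr 1
    funext i
    field_simp
    ring
  have hfc : Continuous f := by
    rw [hf']
    exact continuous_const.add (continuous_finsetSum _ fun j _ => continuous_const.mul
      ((hcY j).comp (by fun_prop)))
  have hsh : Measurable fun (z : ι → ℝ) i => ν i + s * z i := by fun_prop
  have : IsProbabilityMeasure P := hP ▸ Measure.isProbabilityMeasure_map hsh.aemeasurable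
  have hL : MemLp (fun z => e + ∑ j, c j * noiseTerm x i₀ q j z) 4 (stdNormal ι) :=
    (memLp_const e).add (memLp_finsetSum _ fun j _ => (hY j).1.const_mul (c j))
  have hfL : MemLp f 4 P := by
    rw [hP, memLp_map_measure_iff hfc.aestronglyMeasurable hsh.aemeasurable]
    exact (funext hf : (f ∘ fun (z : ι → ℝ) i => ν i + s * z i) = _) ▸ hL
  have hint : ∀ g : ℝ → ℝ, Continuous g → ∫ y, g (f y) ∂P =
      ∫ z, g (e + ∑ j, c j * noiseTerm x i₀ q j z) ∂stdNormal ι := by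
    intro g hg
    rw [hP]
    refine (integral_map hsh.aemeasurable (hg.comp hfc).aestronglyMeasurable).trans ?_
    simp_rw [Function.comp_apply, hf]
  have hmean : ∫ y, f y ∂P = e := by
    have i1 : ∀ j, Integrable (fun z => c j * noiseTerm x i₀ q j z) (stdNormal ι) :=
      fun j => ((hY j).1.integrable (by norm_num)).const_mul _
    rw [hint (fun t => t) continuous_id, integral_add (integrable_const e)
      (integrable_finsetSum _ fun j _ => i1 j), integral_finsetSum _ fun j _ => i1 j]
    simp_rw [integral_const_mul, (hY _).2.1]
    simp
  refine ⟨hfL.mono_exponent (by norm_num), hmean, ?_, ?_⟩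
  · rw [variance_eq_integral hfc.measurable.aemeasurable, hmean,
      hint (fun t => (t - e) ^ 2) (by fun_prop)]
    simp
  · rw [centralMoment]
    simp only [Pi.pow_apply, Pi.sub_apply]
    rw [hmean, hint (fun t => (t - e) ^ 3) (by fun_prop)]
    simp

/-- A linear combination of the noise terms is not almost surely zero: its second difference along
the covariate vector does not vanish. -/
lemma integral_noise_sq_pos (x : ι → ℝ) (hx : ∀ i, x i = 1 ∨ x i = -1) (hbal : ∑ i, x i = 0)
    (i₀ : ι) {q : ℝ} (hq : q ^ 2 * Fintype.card ι = 1) {c : Fin 6 → ℝ} (hc : c 1 + q * c 5 ≠ 0) :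
    0 < ∫ z, (∑ j, c j * noiseTerm x i₀ q j z) ^ 2 ∂stdNormal ι := by
  have hY := noiseTerm_moments x hx i₀ hq
  have hcY := continuous_noiseTerm x i₀ q
  have hcont : Continuous fun z => ∑ j, c j * noiseTerm x i₀ q j z :=
    continuous_finsetSum _ fun j _ => continuous_const.mul (hcY j)
  have hL : MemLp (fun z => ∑ j, c j * noiseTerm x i₀ q j z) ((2 : ℕ) : ENNReal) (stdNormal ι) :=
    (memLp_finsetSum _ fun j _ => (hY j).1.const_mul (c j)).mono_exponent (by norm_num)
  refine (integral_nonneg fun z => sq_nonneg _).lt_of_ne' fun h0 => hc ?_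
  rw [integral_eq_zero_iff_of_nonneg (fun z => sq_nonneg _)
    (integrable_pow_of_memLp hL le_rfl)] at h0
  have hzero := Measure.eq_of_ae_eq h0 (hcont.pow 2) continuous_const
  have hz : ∀ t : ℝ, ∑ j, c j * noiseTerm x i₀ q j (fun i => t * x i) = 0 := fun t =>
    pow_eq_zero_iff two_ne_zero |>.1 (congrFun hzero fun i => t * x i)
  have hx2 : ∀ i, x i ^ 2 = 1 := fun i => by rcases hx i with h | h <;> rw [h] <;> norm_num
  have h1 : ∀ t : ℝ, ∑ i, q * x i * (t * x i) = q * t * Fintype.card ι := fun t => by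
    have : ∀ i, q * x i * (t * x i) = q * t := fun i => by linear_combination q * t * hx2 i
    simp_rw [this]
    rw [Finset.sum_const, Finset.card_univ, nsmul_eq_mul, mul_comm]
  have h2 : ∀ t : ℝ, ∑ i, q * (t * x i) = 0 := fun t => by
    rw [← Finset.mul_sum, ← Finset.mul_sum, hbal, mul_zero, mul_zero]
  have h3 : ∀ t : ℝ, ∑ i, ((t * x i) ^ 2 - 1) = (t ^ 2 - 1) * Fintype.card ι := fun t => by
    have : ∀ i, (t * x i) ^ 2 - 1 = t ^ 2 - 1 := fun i => by linear_combination t ^ 2 * hx2 i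
    simp_rw [this]
    rw [Finset.sum_const, Finset.card_univ, nsmul_eq_mul, mul_comm]
  -- Along `z = t * x` the sum `∑ i, z i` vanishes by balance, and the combination is a quadratic
  -- polynomial in `t`.
  have key : ∀ t : ℝ, c 0 * (q * t * Fintype.card ι) +
      c 1 * ((q * t * Fintype.card ι) ^ 2 - 1) - c 3 + c 4 * (t * x i₀) +
      c 5 * (q * ((t ^ 2 - 1) * Fintype.card ι)) = 0 := fun t => by
    rw [← hz t]
    simp [Fin.sum_univ_succ, noiseTerm, h1, h2, h3, Fin.succ]
    ring
  have k0 := key 0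
  have k1 := key 1
  have k2 := key (-1)
  have hq0 : q ≠ 0 := by
    rintro rfl
    norm_num at hq
  -- Up to the factor `q ^ 2 / 2`, the second difference is `c 1 + q * c 5`, using `q ^ 2 * n = 1`.
  linear_combination (q ^ 2 / 2) * (k1 + k2 - 2 * k0) -
    (c 1 * (q ^ 2 * Fintype.card ι + 1) + q * c 5) * hq

/-- The data law in terms of standardized noise, and the laws of its coordinates. -/
lemma dataLaw_eq_map {κ : Type*} [Fintype κ] (X : Matrix ι κ ℝ) (β : κ → ℝ) (μ : ι → ℝ) (s : ℝ≥0) :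
    dataLaw X β μ s = (stdNormal ι).map (fun z i => (X *ᵥ β) i + μ i + s * z i) ∧
    ∀ i, (dataLaw X β μ s).map (fun y => y i) = gaussianReal ((X *ᵥ β) i + μ i) (s ^ 2) := by
  have h1 : dataLaw X β μ s =
      Measure.pi fun i => gaussianReal ((X *ᵥ β) i + μ i) (s ^ 2) := by
    have : ∀ i, (gaussianReal (μ i) (s ^ 2)).map (fun t => (X *ᵥ β) i + t) =
        gaussianReal ((X *ᵥ β) i + μ i) (s ^ 2) := fun i => by
      rw [gaussianReal_map_const_add, add_comm]
    simp_rw [← this]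
    rw [← Measure.pi_map_pi fun i => by fun_prop]
    rfl
  have h2 : (stdNormal ι).map (fun z i => (X *ᵥ β) i + μ i + s * z i) =
      Measure.pi fun i => gaussianReal ((X *ᵥ β) i + μ i) (s ^ 2) := by
    have : ∀ i, (gaussianReal 0 1).map (fun t => (X *ᵥ β) i + μ i + s * t) =
        gaussianReal ((X *ᵥ β) i + μ i) (s ^ 2) := fun i => by
      have h := Measure.map_map (μ := gaussianReal 0 1) (f := fun t => s * t)
        (g := fun t => (X *ᵥ β) i + μ i + t) (by fun_prop) (by fun_prop)
      rw [gaussianReal_map_const_mul, gaussianReal_map_const_add] at h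
      refine Eq.trans h.symm ?_
      congr 1
      · ring
      · apply NNReal.coe_injective
        simp
    simp_rw [← this]
    rw [← Measure.pi_map_pi fun i => by fun_prop]
  refine ⟨h1.trans h2.symm, fun i => ?_⟩
  rw [h1]
  exact (measurePreserving_eval (fun i => gaussianReal ((X *ᵥ β) i + μ i) (s ^ 2)) i).map_eq

end StandardizedNoise

/-! ### Expansion of both differences in the noise terms -/

section Expansions

variable {ι : Type*} [Fintype ι]

/-- Coefficients of the leave-one-out difference in terms of the noise terms, for slope `b`,
outlier `m` and `q = 1 / √n`. -/
noncomputable def looCoeff (b m τ s q : ℝ) (j : Fin 6) : ℝ :=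
  -- Two sources: the residual sum of squares of the larger model, with weight `n / (n - 2) - n / (n
  -- - 1) = q ^ 2 / ((1 - q ^ 2) * (1 - 2 * q ^ 2))`, and `n * slope ^ 2`, with weight `-1 / (1 - q
  -- ^ 2)`. Here `√n * slope = b / q + m * q + s * W`, so `b / q` produces the growth like `√n`.
  1 / (2 * τ ^ 2) * ![
    -2 * s * m * q ^ 3 / ((1 - q ^ 2) * (1 - 2 * q ^ 2)) - 2 * s * (b / q + m * q) / (1 - q ^ 2),
    -q ^ 2 * s ^ 2 / ((1 - q ^ 2) * (1 - 2 * q ^ 2)) - s ^ 2 / (1 - q ^ 2),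
    -2 * s * m * q ^ 3 / ((1 - q ^ 2) * (1 - 2 * q ^ 2)),
    -q ^ 2 * s ^ 2 / ((1 - q ^ 2) * (1 - 2 * q ^ 2)),
    2 * s * m * q ^ 2 / ((1 - q ^ 2) * (1 - 2 * q ^ 2)),
    q * s ^ 2 / ((1 - q ^ 2) * (1 - 2 * q ^ 2))] j

/-- Coefficients of the elpd difference in terms of the noise terms. -/
noncomputable def elpdCoeff (τ s q : ℝ) (j : Fin 6) : ℝ :=
  -- The larger model errs only through the estimates of mean and slope and the intercept model only
  -- through that of the mean, so slope and outlier affect just the expectation.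
  1 / (2 * τ ^ 2) * ![0, s ^ 2 / (1 + 2 * q ^ 2), 0,
    -q ^ 2 * s ^ 2 / ((1 + q ^ 2) * (1 + 2 * q ^ 2)), 0, 0] j

/-- Expectation of the leave-one-out difference, with `l` its logarithmic part. -/
noncomputable def looMean (b m τ q l : ℝ) : ℝ :=
  -- The contributions of the noise variance `s ^ 2` cancel, here and in `elpdMean`.
  l + 1 / (2 * τ ^ 2) * ((m ^ 2 * q ^ 2 - (b / q + m * q) ^ 2) / (1 - q ^ 2))

/-- Expectation of the elpd difference, with `l` its logarithmic part. -/
noncomputable def elpdMean (b m τ q l : ℝ) : ℝ :=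
  l - 1 / (2 * τ ^ 2) * (m ^ 2 * q ^ 2 * (1 - 2 * q ^ 2) / ((1 + q ^ 2) * (1 + 2 * q ^ 2)) +
    (b / q + m * q) ^ 2 / (1 + q ^ 2))

lemma sum_sq_sub_sub {x : ι → ℝ} (hx : ∀ i, x i = 1 ∨ x i = -1) (hbal : ∑ i, x i = 0) {n : ℝ}
    (hnc : (Fintype.card ι : ℝ) = n) (y : ι → ℝ) (A B : ℝ) :
    ∑ i, (y i - A - x i * B) ^ 2 =
      ∑ i, y i ^ 2 - 2 * A * ∑ i, y i - 2 * B * ∑ i, x i * y i + n * (A ^ 2 + B ^ 2) := by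
  have hx2 : ∀ i, x i ^ 2 = 1 := fun i => by rcases hx i with h | h <;> rw [h] <;> norm_num
  have e : ∀ i, (y i - A - x i * B) ^ 2 = y i ^ 2 - 2 * A * y i - 2 * B * (x i * y i) +
      (A ^ 2 + B ^ 2) + 2 * A * B * x i := fun i => by linear_combination B ^ 2 * hx2 i
  simp_rw [e]
  rw [Finset.sum_add_distrib, Finset.sum_add_distrib, Finset.sum_sub_distrib,
    Finset.sum_sub_distrib, ← Finset.mul_sum, ← Finset.mul_sum, ← Finset.mul_sum, hbal,
    Finset.sum_const, Finset.card_univ, nsmul_eq_mul, hnc]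
  ring

lemma sum_sq_sub {x : ι → ℝ} (hx : ∀ i, x i = 1 ∨ x i = -1) (hbal : ∑ i, x i = 0) {n : ℝ}
    (hnc : (Fintype.card ι : ℝ) = n) (y : ι → ℝ) (A : ℝ) :
    ∑ i, (y i - A) ^ 2 = ∑ i, y i ^ 2 - 2 * A * ∑ i, y i + n * A ^ 2 := by
  simpa using sum_sq_sub_sub hx hbal hnc y A 0

lemma sum_coeff_mul_noiseTerm (x : ι → ℝ) (i₀ : ι) (q : ℝ) (c : Fin 6 → ℝ) (z : ι → ℝ) :
    ∑ j, c j * noiseTerm x i₀ q j z =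
      c 0 * (q * ∑ i, x i * z i) + c 1 * ((q * ∑ i, x i * z i) ^ 2 - 1) + c 2 * (q * ∑ i, z i) +
        c 3 * ((q * ∑ i, z i) ^ 2 - 1) + c 4 * z i₀ +
        c 5 * (q * (∑ i, z i ^ 2 - Fintype.card ι)) := by
  have h1 : ∑ i, q * x i * z i = q * ∑ i, x i * z i := by simp_rw [mul_assoc, Finset.mul_sum]
  have h2 : ∑ i, q * z i = q * ∑ i, z i := by rw [Finset.mul_sum]
  have h3 : ∑ i, (z i ^ 2 - 1) = ∑ i, z i ^ 2 - Fintype.card ι := by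
    rw [Finset.sum_sub_distrib]
    simp
  simp only [Fin.sum_univ_succ, noiseTerm, h1, h2, h3]
  simp [Fin.succ]
  ring

variable [DecidableEq ι]

lemma sums_of_mean_vector {x : ι → ℝ} (hx : ∀ i, x i = 1 ∨ x i = -1) (hbal : ∑ i, x i = 0)
    {i₀ : ι} (hi₀ : x i₀ = 1) {n : ℝ} (hnc : (Fintype.card ι : ℝ) = n) (a b m : ℝ) {ν : ι → ℝ}
    (hν : ∀ i, ν i = a + b * x i + Pi.single (M := fun _ => ℝ) i₀ m i) (z : ι → ℝ) :
    ∑ i, ν i = n * a + m ∧ ∑ i, x i * ν i = n * b + m ∧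
      ∑ i, ν i ^ 2 = n * (a ^ 2 + b ^ 2) + 2 * m * (a + b) + m ^ 2 ∧
      ∑ i, ν i * z i = a * ∑ i, z i + b * ∑ i, x i * z i + m * z i₀ := by
  have hx2 : ∀ i, x i ^ 2 = 1 := fun i => by rcases hx i with h | h <;> rw [h] <;> norm_num
  have hz : ∀ w : ι → ℝ, ∑ i, ν i * w i = a * ∑ i, w i + b * ∑ i, x i * w i + m * w i₀ := by
    intro w
    have e : ∀ i, ν i * w i =
        a * w i + b * (x i * w i) + Pi.single (M := fun _ => ℝ) i₀ m i * w i := fun i => by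
      rw [hν]; ring
    simp_rw [e]
    rw [Finset.sum_add_distrib, Finset.sum_add_distrib, ← Finset.mul_sum, ← Finset.mul_sum]
    simp [Pi.single_apply]
  have h1 : ∑ i, ν i = n * a + m := by
    have := hz fun _ => 1
    simp only [mul_one, hbal, Finset.sum_const, Finset.card_univ, nsmul_eq_mul, hnc] at this
    rw [this]; ring
  have h2 : ∑ i, x i * ν i = n * b + m := by
    have := hz x
    simp_rw [mul_comm (ν _), ← sq, hx2] at this
    simp only [mul_one, hbal, hi₀, Finset.sum_const, Finset.card_univ, nsmul_eq_mul, hnc] at this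
    rw [this]; ring
  have h3 := hz ν
  rw [h1, h2, hν i₀, hi₀, Pi.single_eq_same] at h3
  simp_rw [← sq] at h3
  exact ⟨h1, h2, by rw [h3]; ring, hz z⟩

lemma sums_of_response {x : ι → ℝ} (hx : ∀ i, x i = 1 ∨ x i = -1) (hbal : ∑ i, x i = 0)
    {i₀ : ι} (hi₀ : x i₀ = 1) {n : ℝ} (hnc : (Fintype.card ι : ℝ) = n) (a b m s : ℝ) {ν : ι → ℝ}
    (hν : ∀ i, ν i = a + b * x i + Pi.single (M := fun _ => ℝ) i₀ m i) (z : ι → ℝ) :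
    ∑ i, (ν i + s * z i) = n * a + m + s * ∑ i, z i ∧
      ∑ i, x i * (ν i + s * z i) = n * b + m + s * ∑ i, x i * z i ∧
      ∑ i, (ν i + s * z i) ^ 2 = n * (a ^ 2 + b ^ 2) + 2 * m * (a + b) + m ^ 2 +
        2 * s * (a * ∑ i, z i + b * ∑ i, x i * z i + m * z i₀) + s ^ 2 * ∑ i, z i ^ 2 := by
  obtain ⟨h1, h2, h3, h4⟩ := sums_of_mean_vector hx hbal hi₀ hnc a b m hν z
  refine ⟨?_, ?_, ?_⟩
  · rw [Finset.sum_add_distrib, h1, ← Finset.mul_sum]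
  · have : ∀ i, x i * (ν i + s * z i) = x i * ν i + s * (x i * z i) := fun i => by ring
    simp_rw [this]
    rw [Finset.sum_add_distrib, h2, ← Finset.mul_sum]
  · have : ∀ i, (ν i + s * z i) ^ 2 = ν i ^ 2 + 2 * s * (ν i * z i) + s ^ 2 * z i ^ 2 :=
      fun i => by ring
    simp_rw [this]
    rw [Finset.sum_add_distrib, Finset.sum_add_distrib, h3, ← Finset.mul_sum, ← Finset.mul_sum, h4]

lemma looDiff_expansion {x : ι → ℝ} (hx : ∀ i, x i = 1 ∨ x i = -1) (hbal : ∑ i, x i = 0)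
    {i₀ : ι} (hi₀ : x i₀ = 1) (hn : 4 ≤ Fintype.card ι) {n q : ℝ}
    (hnc : (Fintype.card ι : ℝ) = n) (hq : 0 < q) (hqn : n = (q ^ 2)⁻¹) (a b m : ℝ) {τ s : ℝ≥0}
    (hτ : 0 < τ) {ν : ι → ℝ} (hν : ∀ i, ν i = a + b * x i + Pi.single (M := fun _ => ℝ) i₀ m i)
    (z : ι → ℝ) :
    looDiff τ (interceptDesign x) {0} {0, 1} (fun i => ν i + s * z i) =
      looMean b m τ q (n / 2 * Real.log ((n - 1) / (n - 2))) +
        ∑ j, looCoeff b m τ s q j * noiseTerm x i₀ q j z := by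
  have hτ' : (0 : ℝ) < τ := hτ
  have hn4 : (4 : ℝ) ≤ n := by rw [← hnc]; exact_mod_cast hn
  obtain ⟨h1, h2, h3⟩ := sums_of_response hx hbal hi₀ hnc a b m s hν z
  rw [looDiff_eq hτ x _ hx hbal hn hnc, sum_sq_sub_sub hx hbal hnc, sum_sq_sub hx hbal hnc,
    sum_coeff_mul_noiseTerm, mean, slope, h1, h2, h3, hnc, looMean]
  generalize n / 2 * Real.log ((n - 1) / (n - 2)) = l
  have hq1 : 1 - q ^ 2 = (n - 1) * q ^ 2 := by rw [hqn]; field_simp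
  have hq2 : 1 - 2 * q ^ 2 = (n - 2) * q ^ 2 := by rw [hqn]; field_simp
  have hd1 : 1 - q ^ 2 ≠ 0 := by
    rw [hq1]; exact mul_ne_zero (by linarith) (by positivity)
  have hd2 : 1 - 2 * q ^ 2 ≠ 0 := by
    rw [hq2]; exact mul_ne_zero (by linarith) (by positivity)
  have e1 : n / (n - 1) = 1 / (1 - q ^ 2) := by
    rw [hq1, hqn]
    field_simp
  have e2 : n / (n - 2) = 1 / (1 - 2 * q ^ 2) := by
    rw [hq2, hqn]
    field_simp
  rw [e1, e2, hqn]
  generalize ∑ i, z i ^ 2 = Z2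
  generalize ∑ i, x i * z i = Sx
  generalize ∑ i, z i = S
  simp [looCoeff]
  field_simp
  ring

lemma elpdDiff_expansion {x : ι → ℝ} (hx : ∀ i, x i = 1 ∨ x i = -1) (hbal : ∑ i, x i = 0)
    {i₀ : ι} (hi₀ : x i₀ = 1) (hn : 4 ≤ Fintype.card ι) {n q : ℝ}
    (hnc : (Fintype.card ι : ℝ) = n) (hq : 0 < q) (hqn : n = (q ^ 2)⁻¹) (a b m : ℝ) {τ s : ℝ≥0}
    (hτ : 0 < τ) {ν : ι → ℝ} (hν : ∀ i, ν i = a + b * x i + Pi.single (M := fun _ => ℝ) i₀ m i)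
    {P : Measure (ι → ℝ)} (hP : ∀ i, P.map (fun y => y i) = gaussianReal (ν i) (s ^ 2))
    (z : ι → ℝ) :
    elpdDiff P τ (interceptDesign x) {0} {0, 1} (fun i => ν i + s * z i) =
      elpdMean b m τ q (n / 2 * Real.log ((n + 2) / (n + 1))) +
        ∑ j, elpdCoeff τ s q j * noiseTerm x i₀ q j z := by
  have hτ' : (0 : ℝ) < τ := hτ
  obtain ⟨h1, h2, h3⟩ := sums_of_response hx hbal hi₀ hnc a b m s hν z
  obtain ⟨k1, k2, k3, -⟩ := sums_of_mean_vector hx hbal hi₀ hnc a b m hν z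
  rw [elpdDiff_eq hτ x _ ν hP hx hbal hn hnc, sum_sq_sub_sub hx hbal hnc, sum_sq_sub hx hbal hnc,
    sum_coeff_mul_noiseTerm, mean, slope, h1, h2, k1, k2, k3, hnc, elpdMean]
  generalize n / 2 * Real.log ((n + 2) / (n + 1)) = l
  have e1 : n / (n + 1) = 1 / (1 + q ^ 2) := by
    rw [hqn]
    field_simp
  have e2 : n / (n + 2) = 1 / (1 + 2 * q ^ 2) := by
    rw [hqn]
    field_simp
  rw [e1, e2, hqn]
  generalize ∑ i, z i ^ 2 = Z2
  generalize ∑ i, x i * z i = Sx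
  generalize ∑ i, z i = S
  simp [elpdCoeff]
  field_simp
  ring

end Expansions

/-! ### Limits of coefficients and means -/

section Asymptotics

/-- The shift `c` absorbs the offset between `n` and `u`: `u = n - 2` for leave-one-out and `u = n +
1` for the elpd. -/
lemma tendsto_mul_log_one_add_inv (c : ℝ) :
    Tendsto (fun u : ℝ => (u + c) / 2 * Real.log (1 + 1 / u)) atTop (𝓝 (1 / 2)) := by
  have h1 := Real.tendsto_mul_log_one_add_div_atTop 1
  have h2 : Tendsto (fun u : ℝ => Real.log (1 + 1 / u)) atTop (𝓝 0) := by
    have h : Tendsto (fun u : ℝ => 1 + 1 / u) atTop (𝓝 (1 + 0)) :=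
      (tendsto_const_nhds.div_atTop tendsto_id).const_add 1
    rw [add_zero] at h
    simpa using h.log one_ne_zero
  have h3 := (h1.const_mul (1 / 2)).add (h2.const_mul (c / 2))
  simp only [mul_one, mul_zero, add_zero] at h3
  exact h3.congr fun u => by ring

lemma tendsto_loo_log {n : ℕ → ℝ} (hn : Tendsto n atTop atTop) :
    Tendsto (fun k => n k / 2 * Real.log ((n k - 1) / (n k - 2))) atTop (𝓝 (1 / 2)) := by
  have h := (tendsto_mul_log_one_add_inv 2).comp (tendsto_atTop_add_const_right atTop (-2) hn)
  refine h.congr' ?_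
  filter_upwards [hn.eventually_gt_atTop 2] with k hk
  have : n k - 2 ≠ 0 := by linarith
  simp only [Function.comp_apply, ← sub_eq_add_neg]
  rw [sub_add_cancel]
  congr 2
  field_simp
  ring

lemma tendsto_elpd_log {n : ℕ → ℝ} (hn : Tendsto n atTop atTop) :
    Tendsto (fun k => n k / 2 * Real.log ((n k + 2) / (n k + 1))) atTop (𝓝 (1 / 2)) := by
  have h := (tendsto_mul_log_one_add_inv (-1)).comp (tendsto_atTop_add_const_right atTop 1 hn)
  refine h.congr' ?_
  filter_upwards [hn.eventually_gt_atTop 2] with k hk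
  have : n k + 1 ≠ 0 := by linarith
  simp only [Function.comp_apply]
  rw [add_neg_cancel_right]
  congr 2
  field_simp
  ring

/-- The formulas contain `b / t`, whose default value at `t = 0` is meaningless here. Replacing `f`
by a continuous `g` with the singularity removed turns limits into evaluation at zero. -/
lemma tendsto_comp_of_continuousAt_zero {q : ℕ → ℝ} (hq : Tendsto q atTop (𝓝 0))
    (hq0 : ∀ k, q k ≠ 0) {f g : ℝ → ℝ} {L : ℝ} (hfg : ∀ t, t ≠ 0 → f t = g t)
    (hg : ContinuousAt g 0) (hL : g 0 = L) : Tendsto (fun k => f (q k)) atTop (𝓝 L) := by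
  rw [← hL]
  exact (hg.tendsto.comp hq).congr fun k => (hfg _ (hq0 k)).symm

variable {q : ℕ → ℝ}

lemma tendsto_looCoeff_zero (hq : Tendsto q atTop (𝓝 0)) (hq0 : ∀ k, q k ≠ 0) (m τ s : ℝ)
    (j : Fin 6) : Tendsto (fun k => looCoeff 0 m τ s (q k) j) atTop
      (𝓝 (![0, -(s ^ 2 / (2 * τ ^ 2)), 0, 0, 0, 0] j)) := by
  refine tendsto_comp_of_continuousAt_zero hq hq0 (f := fun t => looCoeff 0 m τ s t j)
    (g := fun t => 1 / (2 * τ ^ 2) * ![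
      -2 * s * m * t ^ 3 / ((1 - t ^ 2) * (1 - 2 * t ^ 2)) - 2 * s * (m * t) / (1 - t ^ 2),
      -t ^ 2 * s ^ 2 / ((1 - t ^ 2) * (1 - 2 * t ^ 2)) - s ^ 2 / (1 - t ^ 2),
      -2 * s * m * t ^ 3 / ((1 - t ^ 2) * (1 - 2 * t ^ 2)),
      -t ^ 2 * s ^ 2 / ((1 - t ^ 2) * (1 - 2 * t ^ 2)),
      2 * s * m * t ^ 2 / ((1 - t ^ 2) * (1 - 2 * t ^ 2)),
      t * s ^ 2 / ((1 - t ^ 2) * (1 - 2 * t ^ 2))] j)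
    (fun t _ => by rw [looCoeff, zero_div, zero_add]) ?_ ?_
  · fin_cases j <;> simp <;> fun_prop (disch := norm_num)
  · fin_cases j <;> simp
    ring

/-- Scaling by `q` compensates `b / q` in the coefficient of `W` and kills all other, bounded,
coefficients. -/
lemma tendsto_mul_looCoeff (hq : Tendsto q atTop (𝓝 0)) (hq0 : ∀ k, q k ≠ 0) (b m τ s : ℝ)
    (j : Fin 6) : Tendsto (fun k => q k * looCoeff b m τ s (q k) j) atTop
      (𝓝 (![-(s * b / τ ^ 2), 0, 0, 0, 0, 0] j)) := by
  refine tendsto_comp_of_continuousAt_zero hq hq0 (f := fun t => t * looCoeff b m τ s t j)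
    (g := fun t => 1 / (2 * τ ^ 2) * ![
      -2 * s * m * t ^ 4 / ((1 - t ^ 2) * (1 - 2 * t ^ 2)) - 2 * s * (b + m * t ^ 2) / (1 - t ^ 2),
      t * (-t ^ 2 * s ^ 2 / ((1 - t ^ 2) * (1 - 2 * t ^ 2)) - s ^ 2 / (1 - t ^ 2)),
      t * (-2 * s * m * t ^ 3 / ((1 - t ^ 2) * (1 - 2 * t ^ 2))),
      t * (-t ^ 2 * s ^ 2 / ((1 - t ^ 2) * (1 - 2 * t ^ 2))),
      t * (2 * s * m * t ^ 2 / ((1 - t ^ 2) * (1 - 2 * t ^ 2))),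
      t * (t * s ^ 2 / ((1 - t ^ 2) * (1 - 2 * t ^ 2)))] j) (fun t ht => ?_) ?_ ?_
  · have e : b / t + m * t = (b + m * t ^ 2) / t := by field_simp
    rw [looCoeff, mul_left_comm, e]
    congr 1
    fin_cases j
    · have : t * (2 * s * ((b + m * t ^ 2) / t) / (1 - t ^ 2)) =
          2 * s * (b + m * t ^ 2) / (1 - t ^ 2) := by
        field_simp
      simp only [Fin.zero_eta, Matrix.cons_val_zero]
      rw [mul_sub, this]
      ring
    all_goals simp
  · fin_cases j <;> simp <;> fun_prop (disch := norm_num)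
  · fin_cases j <;> simp
    ring

lemma tendsto_elpdCoeff (hq : Tendsto q atTop (𝓝 0)) (hq0 : ∀ k, q k ≠ 0) (τ s : ℝ)
    (j : Fin 6) : Tendsto (fun k => elpdCoeff τ s (q k) j) atTop
      (𝓝 (![0, s ^ 2 / (2 * τ ^ 2), 0, 0, 0, 0] j)) := by
  refine tendsto_comp_of_continuousAt_zero hq hq0 (f := fun t => elpdCoeff τ s t j)
    (fun t _ => rfl) ?_ ?_
  · unfold elpdCoeff
    have h (t : ℝ) : 1 + t ^ 2 ≠ 0 := by positivity
    have h' (t : ℝ) : 1 + 2 * t ^ 2 ≠ 0 := by positivity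
    fin_cases j <;> simp <;> fun_prop (disch := simp)
  · fin_cases j <;> simp [elpdCoeff]
    ring

lemma looMean_zero (m τ t l : ℝ) : looMean 0 m τ t l = l := by
  simp [looMean]
  ring_nf
  simp

lemma tendsto_elpdMean_zero (hq : Tendsto q atTop (𝓝 0)) (hq0 : ∀ k, q k ≠ 0) (m τ : ℝ)
    {l : ℕ → ℝ} {L : ℝ} (hl : Tendsto l atTop (𝓝 L)) :
    Tendsto (fun k => elpdMean 0 m τ (q k) (l k)) atTop (𝓝 L) := by
  have h : Tendsto (fun k => elpdMean 0 m τ (q k) 0) atTop (𝓝 0) := by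
    refine tendsto_comp_of_continuousAt_zero hq hq0 (f := fun t => elpdMean 0 m τ t 0)
      (fun t _ => by rw [elpdMean, zero_div]) ?_ ?_
    · fun_prop (disch := simp)
    · simp
  have := hl.add h
  rw [add_zero] at this
  exact this.congr fun k => by simp only [elpdMean]; ring

lemma tendsto_sq_mul_looMean (hq : Tendsto q atTop (𝓝 0)) (hq0 : ∀ k, q k ≠ 0) (b m τ : ℝ)
    {l : ℕ → ℝ} {L : ℝ} (hl : Tendsto l atTop (𝓝 L)) :
    Tendsto (fun k => q k ^ 2 * looMean b m τ (q k) (l k)) atTop (𝓝 (-(b ^ 2 / (2 * τ ^ 2)))) := by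
  have h : Tendsto (fun k => q k ^ 2 * looMean b m τ (q k) 0) atTop
      (𝓝 (-(b ^ 2 / (2 * τ ^ 2)))) := by
    refine tendsto_comp_of_continuousAt_zero hq hq0 (f := fun t => t ^ 2 * looMean b m τ t 0)
      (g := fun t => 1 / (2 * τ ^ 2) * ((m ^ 2 * t ^ 4 - (b + m * t ^ 2) ^ 2) / (1 - t ^ 2)))
      (fun t ht => ?_) ?_ ?_
    · have e : b / t + m * t = (b + m * t ^ 2) / t := by field_simp
      have e' : t ^ 2 * (m ^ 2 * t ^ 2 - ((b + m * t ^ 2) / t) ^ 2) =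
          m ^ 2 * t ^ 4 - (b + m * t ^ 2) ^ 2 := by field_simp
      rw [looMean, e, ← e']
      ring
    · fun_prop (disch := norm_num)
    · simp
      ring
  have := ((hq.pow 2).mul hl).add h
  simp only [ne_eq, OfNat.ofNat_ne_zero, not_false_eq_true, zero_pow, zero_mul, zero_add] at this
  exact this.congr fun k => by simp only [looMean]; ring

lemma tendsto_sq_mul_elpdMean (hq : Tendsto q atTop (𝓝 0)) (hq0 : ∀ k, q k ≠ 0) (b m τ : ℝ)
    {l : ℕ → ℝ} {L : ℝ} (hl : Tendsto l atTop (𝓝 L)) :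
    Tendsto (fun k => q k ^ 2 * elpdMean b m τ (q k) (l k)) atTop
      (𝓝 (-(b ^ 2 / (2 * τ ^ 2)))) := by
  have h : Tendsto (fun k => q k ^ 2 * elpdMean b m τ (q k) 0) atTop
      (𝓝 (-(b ^ 2 / (2 * τ ^ 2)))) := by
    refine tendsto_comp_of_continuousAt_zero hq hq0 (f := fun t => t ^ 2 * elpdMean b m τ t 0)
      (g := fun t => -(1 / (2 * τ ^ 2) *
        (m ^ 2 * t ^ 4 * (1 - 2 * t ^ 2) / ((1 + t ^ 2) * (1 + 2 * t ^ 2)) +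
          (b + m * t ^ 2) ^ 2 / (1 + t ^ 2)))) (fun t ht => ?_) ?_ ?_
    · have e : b / t + m * t = (b + m * t ^ 2) / t := by field_simp
      have e' : t ^ 2 * ((b + m * t ^ 2) / t) ^ 2 = (b + m * t ^ 2) ^ 2 := by field_simp
      rw [elpdMean, e, ← e']
      ring
    · fun_prop (disch := simp)
    · simp
      ring
  have := ((hq.pow 2).mul hl).add h
  simp only [ne_eq, OfNat.ofNat_ne_zero, not_false_eq_true, zero_pow, zero_mul, zero_add] at this
  exact this.congr fun k => by simp only [elpdMean]; ring

/-- Both means contain `(b / q + m * q) ^ 2`, of order `n`, but with factors `1 / (1 - q ^ 2)` and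
`1 / (1 + q ^ 2)` that differ by `O(q ^ 2)`. The difference of the means stays bounded. -/
lemma tendsto_mul_sub_mean (hq : Tendsto q atTop (𝓝 0)) (hq0 : ∀ k, q k ≠ 0)
    (hq1 : ∀ k, q k ^ 2 < 1) (b m τ : ℝ)
    {l l' : ℕ → ℝ} {L L' : ℝ} (hl : Tendsto l atTop (𝓝 L)) (hl' : Tendsto l' atTop (𝓝 L')) :
    Tendsto (fun k => q k * (looMean b m τ (q k) (l k) - elpdMean b m τ (q k) (l' k))) atTop
      (𝓝 0) := by
  have h : Tendsto (fun k => 1 / (2 * τ ^ 2) * (m ^ 2 * q k ^ 3 / (1 - q k ^ 2) +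
      m ^ 2 * q k ^ 3 * (1 - 2 * q k ^ 2) / ((1 + q k ^ 2) * (1 + 2 * q k ^ 2)) -
        2 * q k * (b + m * q k ^ 2) ^ 2 / ((1 - q k ^ 2) * (1 + q k ^ 2)))) atTop (𝓝 0) := by
    refine tendsto_comp_of_continuousAt_zero hq hq0 (f := fun t => 1 / (2 * τ ^ 2) *
      (m ^ 2 * t ^ 3 / (1 - t ^ 2) +
        m ^ 2 * t ^ 3 * (1 - 2 * t ^ 2) / ((1 + t ^ 2) * (1 + 2 * t ^ 2)) -
          2 * t * (b + m * t ^ 2) ^ 2 / ((1 - t ^ 2) * (1 + t ^ 2)))) (fun t _ => rfl) ?_ ?_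
    · fun_prop (disch := simp)
    · simp
  have := (hq.mul (hl.sub hl')).add h
  simp only [zero_mul, zero_add] at this
  refine this.congr fun k => ?_
  have h1 : 1 - q k ^ 2 ≠ 0 := (sub_pos.2 (hq1 k)).ne'
  have h2 : 1 + q k ^ 2 ≠ 0 := by positivity
  have h3 : 1 + 2 * q k ^ 2 ≠ 0 := by positivity
  have h0 := hq0 k
  have e : b / q k + m * q k = (b + m * q k ^ 2) / q k := by field_simp
  have e' : 2 * q k * (b + m * q k ^ 2) ^ 2 / ((1 - q k ^ 2) * (1 + q k ^ 2)) =
      q k * (((b + m * q k ^ 2) / q k) ^ 2 / (1 - q k ^ 2) -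
        ((b + m * q k ^ 2) / q k) ^ 2 / (1 + q k ^ 2)) := by
    field_simp
    ring
  rw [looMean, elpdMean, e, e']
  ring

end Asymptotics

/-! ### From rescaled moments to ratios and skewness -/

section Limits

/-- Limits of the rescaled variance and third central moment. -/
lemma tendsto_rescaled_moments {N : ℕ → ℕ} {x : (k : ℕ) → Fin (N k) → ℝ}
    (hx : ∀ k i, x k i = 1 ∨ x k i = -1) {out : (k : ℕ) → Fin (N k)} {q : ℕ → ℝ}
    (hq : ∀ k, q k ^ 2 * Fintype.card (Fin (N k)) = 1) {c : ℕ → Fin 6 → ℝ} {lam : ℕ → ℝ} {a b : ℝ}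
    (hc : ∀ j, Tendsto (fun k => lam k * c k j) atTop (𝓝 (![a, b, 0, 0, 0, 0] j)))
    {V T : ℕ → ℝ}
    (hV : ∀ k, V k =
      ∫ z, (∑ j, c k j * noiseTerm (x k) (out k) (q k) j z) ^ 2 ∂stdNormal (Fin (N k)))
    (hT : ∀ k, T k =
      ∫ z, (∑ j, c k j * noiseTerm (x k) (out k) (q k) j z) ^ 3 ∂stdNormal (Fin (N k))) :
    Tendsto (fun k => lam k ^ 2 * V k) atTop (𝓝 (a ^ 2 + 2 * b ^ 2)) ∧
      Tendsto (fun k => lam k ^ 3 * T k) atTop (𝓝 (8 * b ^ 3 + 6 * a ^ 2 * b)) := by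
  have hm := fun k => noiseTerm_moments (x k) (hx k) (out k) (hq k)
  have key := fun {p : ℕ} (hp : p ≤ 4) => tendsto_integral_pow_sub
    (P := fun k => stdNormal (Fin (N k)))
    (Y := fun k => noiseTerm (x k) (out k) (q k)) (fun k j => (hm k j).1)
    (fun k j => (hm k j).2.2) hc hp
  have hlim := fun k => integral_noise_limit (x k) (hx k) (out k) (hq k) a b
  have hscale : ∀ (p k : ℕ),
      ∫ z, (∑ j, lam k * c k j * noiseTerm (x k) (out k) (q k) j z) ^ p ∂stdNormal (Fin (N k)) =
      lam k ^ p *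
        ∫ z, (∑ j, c k j * noiseTerm (x k) (out k) (q k) j z) ^ p ∂stdNormal (Fin (N k)) := by
    intro p k
    rw [← integral_const_mul]
    simp_rw [← mul_pow, Finset.mul_sum, mul_assoc]
  constructor
  · have h := (key (p := 2) (by norm_num)).add_const (a ^ 2 + 2 * b ^ 2)
    rw [zero_add] at h
    refine h.congr fun k => ?_
    rw [(hlim k).1, sub_add_cancel, hscale, hV]
  · have h := (key (p := 3) (by norm_num)).add_const (8 * b ^ 3 + 6 * a ^ 2 * b)
    rw [zero_add] at h
    refine h.congr fun k => ?_
    rw [(hlim k).2, sub_add_cancel, hscale, hT]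

lemma div_sqrt_rescale {l e v : ℝ} (hl : 0 < l) : e / √v = l * e / √(l ^ 2 * v) := by
  rw [Real.sqrt_mul (sq_nonneg l), Real.sqrt_sq hl.le, mul_div_mul_left _ _ hl.ne']

lemma tendsto_div_sqrt {lam e V : ℕ → ℝ} (hlam : ∀ k, 0 < lam k) {E W : ℝ} (hW : 0 < W)
    (he : Tendsto (fun k => lam k * e k) atTop (𝓝 E))
    (hV : Tendsto (fun k => lam k ^ 2 * V k) atTop (𝓝 W)) :
    Tendsto (fun k => e k / √(V k)) atTop (𝓝 (E / √W)) := by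
  simp_rw [fun k => div_sqrt_rescale (e := e k) (v := V k) (hlam k)]
  exact he.div hV.sqrt (Real.sqrt_pos.2 hW).ne'

lemma tendsto_div_sqrt_atBot {lam e V : ℕ → ℝ} (hlam : ∀ k, 0 < lam k) {W : ℝ} (hW : 0 < W)
    (he : Tendsto (fun k => lam k * e k) atTop atBot)
    (hV : Tendsto (fun k => lam k ^ 2 * V k) atTop (𝓝 W)) :
    Tendsto (fun k => e k / √(V k)) atTop atBot := by
  simp_rw [fun k => div_sqrt_rescale (e := e k) (v := V k) (hlam k), div_eq_mul_inv]
  have hW' := Real.sqrt_pos.2 hW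
  exact he.atBot_mul_pos (inv_pos.2 hW') (hV.sqrt.inv₀ hW'.ne')

/-- Skewness is invariant under positive scaling, so `lam` may be inserted freely. -/
lemma tendsto_div_rpow {lam T V : ℕ → ℝ} (hlam : ∀ k, 0 < lam k) (hV0 : ∀ k, 0 < V k) {S W : ℝ}
    (hW : 0 < W) (hT : Tendsto (fun k => lam k ^ 3 * T k) atTop (𝓝 S))
    (hV : Tendsto (fun k => lam k ^ 2 * V k) atTop (𝓝 W)) :
    Tendsto (fun k => T k / V k ^ (3 / 2 : ℝ)) atTop (𝓝 (S / W ^ (3 / 2 : ℝ))) := by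
  have h := hT.div (hV.rpow_const (p := 3 / 2) (Or.inl hW.ne')) (Real.rpow_pos_of_pos hW _).ne'
  refine h.congr fun k => ?_
  have hl := hlam k
  have e : (lam k ^ 2) ^ (3 / 2 : ℝ) = lam k ^ 3 := by
    rw [← Real.rpow_natCast, ← Real.rpow_mul hl.le, ← Real.rpow_natCast]
    norm_num
  rw [Pi.div_apply, Real.mul_rpow (by positivity) (hV0 k).le, e,
    mul_div_mul_left _ _ (by positivity)]

end Limits

/-! ### Nondegeneracy and the main theorem -/

lemma sum_eq_zero_of_balanced {ι : Type*} [Fintype ι] {x : ι → ℝ}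
    (hx : ∀ i, x i = 1 ∨ x i = -1)
    (h : (Finset.univ.filter fun i => x i = 1).card = (Finset.univ.filter fun i => x i = -1).card) :
    ∑ i, x i = 0 := by
  have e : ∀ i, x i = (if x i = 1 then (1 : ℝ) else 0) - if x i = -1 then (1 : ℝ) else 0 := by
    intro i
    rcases hx i with h | h <;> rw [h] <;> norm_num
  rw [Finset.sum_congr rfl fun i _ => e i, Finset.sum_sub_distrib, Finset.sum_boole,
    Finset.sum_boole, h, sub_self]

lemma interceptDesign_mulVec {ι : Type*} (x : ι → ℝ) (a b : ℝ) (i : ι) :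
    (interceptDesign x *ᵥ ![a, b]) i = a + b * x i := by
  simp [interceptDesign, Matrix.mulVec, dotProduct, Fin.sum_univ_two, mul_comm]

/-- This is the quantity required by `integral_noise_sq_pos`. It is negative for leave-one-out and
positive for the elpd, so it is also nonzero for their difference, the error. -/
lemma looCoeff_add_neg {b m τ s q : ℝ} (hτ : 0 < τ) (hs : 0 < s) (hq : 2 * q ^ 2 < 1) :
    looCoeff b m τ s q 1 + q * looCoeff b m τ s q 5 < 0 := by
  have h1 : 0 < 1 - q ^ 2 := by nlinarith [sq_nonneg q]
  have e : looCoeff b m τ s q 1 + q * looCoeff b m τ s q 5 =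
      -(1 / (2 * τ ^ 2) * (s ^ 2 / (1 - q ^ 2))) := by
    simp [looCoeff]
    ring
  rw [e]
  have : 0 < 1 / (2 * τ ^ 2) * (s ^ 2 / (1 - q ^ 2)) := by positivity
  linarith

lemma elpdCoeff_add_pos {τ s : ℝ} (q : ℝ) (hτ : 0 < τ) (hs : 0 < s) :
    0 < elpdCoeff τ s q 1 + q * elpdCoeff τ s q 5 := by
  have e : elpdCoeff τ s q 1 + q * elpdCoeff τ s q 5 =
      1 / (2 * τ ^ 2) * (s ^ 2 / (1 + 2 * q ^ 2)) := by
    simp [elpdCoeff]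
  rw [e]
  positivity

end LinRegCV

/-- For each `k` there are `n = 2 * k + 4` observations (all even `n ≥ 4`); half of the covariate
values are `1` and half are `-1`. The noise is `N(μ, s² I)`, where `μ` vanishes except for the
value `m` at the index `out k`, at which the covariate is `1`. Model `{0}` is intercept-only and
model `{0, 1}` has the intercept and the covariate. -/
theorem mainTheorem1 (β₀ βΔ m : ℝ) (τ s : ℝ≥0) (hτ : 0 < τ) (hs : 0 < s)
    (x : (k : ℕ) → Fin (2 * k + 4) → ℝ)
    (hx : ∀ k i, x k i = 1 ∨ x k i = -1)
    (hbal : ∀ k, (Finset.univ.filter fun i => x k i = 1).card =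
      (Finset.univ.filter fun i => x k i = -1).card)
    (out : (k : ℕ) → Fin (2 * k + 4)) (hout : ∀ k, x k (out k) = 1)
    (X : (k : ℕ) → Matrix (Fin (2 * k + 4)) (Fin 2) ℝ)
    (hX : ∀ k, X k = LinRegCV.interceptDesign (x k))
    (P : (k : ℕ) → Measure (Fin (2 * k + 4) → ℝ))
    (hP : ∀ k, P k = LinRegCV.dataLaw (X k) ![β₀, βΔ] (Pi.single (out k) m) s)
    (loo elpd err : (k : ℕ) → (Fin (2 * k + 4) → ℝ) → ℝ)
    (hloo : ∀ k, loo k = LinRegCV.looDiff τ (X k) {0} {0, 1})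
    (helpd : ∀ k, elpd k = LinRegCV.elpdDiff (P k) τ (X k) {0} {0, 1})
    (herr : ∀ k, err k = LinRegCV.looError (P k) τ (X k) {0} {0, 1}) :
    -- the moments involved exist and the variances do not vanish
    (∀ k, (MemLp (loo k) 3 (P k) ∧ 0 < variance (loo k) (P k)) ∧
      (MemLp (elpd k) 3 (P k) ∧ 0 < variance (elpd k) (P k)) ∧
      (MemLp (err k) 3 (P k) ∧ 0 < variance (err k) (P k))) ∧
    -- relative mean of the leave-one-out estimate
    (βΔ = 0 → Tendsto (fun k => LinRegCV.meanOverSD (P k) (loo k)) atTop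
      (𝓝 ((τ : ℝ) ^ 2 / (√2 * (s : ℝ) ^ 2)))) ∧
    (βΔ ≠ 0 → Tendsto (fun k => LinRegCV.meanOverSD (P k) (loo k)) atTop atBot) ∧
    -- relative mean of the elpd difference
    (βΔ = 0 → Tendsto (fun k => LinRegCV.meanOverSD (P k) (elpd k)) atTop
      (𝓝 ((τ : ℝ) ^ 2 / (√2 * (s : ℝ) ^ 2)))) ∧
    (βΔ ≠ 0 → Tendsto (fun k => LinRegCV.meanOverSD (P k) (elpd k)) atTop atBot) ∧
    -- relative mean of the error
    Tendsto (fun k => LinRegCV.meanOverSD (P k) (err k)) atTop (𝓝 0) ∧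
    -- skewness of the error
    (βΔ = 0 → Tendsto (fun k => LinRegCV.skewness (P k) (err k)) atTop
      (𝓝 (-(2 : ℝ) ^ (3 / 2 : ℝ)))) ∧
    (βΔ ≠ 0 → Tendsto (fun k => LinRegCV.skewness (P k) (err k)) atTop (𝓝 0)) := by
  set n : ℕ → ℝ := fun k => (2 * k + 4 : ℕ) with hn
  set q : ℕ → ℝ := fun k => (√(n k))⁻¹ with hq
  have hτ' : (0 : ℝ) < τ := hτ
  have hs' : (0 : ℝ) < s := hs
  have hn4 : ∀ k, 4 ≤ n k := fun k => by
    simp only [hn]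
    push_cast
    linarith [(Nat.cast_nonneg k : (0 : ℝ) ≤ k)]
  have hq0 : ∀ k, 0 < q k := fun k => inv_pos.2 (Real.sqrt_pos.2 (by linarith [hn4 k]))
  have hqn : ∀ k, n k = (q k ^ 2)⁻¹ := fun k => by
    simp only [hq]
    rw [inv_pow, inv_inv, Real.sq_sqrt (by linarith [hn4 k])]
  have hq2 : ∀ k, q k ^ 2 * n k = 1 := fun k => by
    rw [hqn]
    exact mul_inv_cancel₀ (pow_pos (hq0 k) 2).ne'
  have hcard : ∀ k, (Fintype.card (Fin (2 * k + 4)) : ℝ) = n k := fun k => by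
    rw [Fintype.card_fin]
  have hqc : ∀ k, q k ^ 2 * Fintype.card (Fin (2 * k + 4)) = 1 := fun k => by rw [hcard, hq2]
  have hq12 : ∀ k, 2 * q k ^ 2 < 1 := fun k => by nlinarith [hq2 k, hn4 k, pow_pos (hq0 k) 2]
  have hq1 : ∀ k, q k ^ 2 < 1 := fun k => by nlinarith [hq12 k, pow_pos (hq0 k) 2]
  have hnt : Tendsto n atTop atTop := by
    refine tendsto_natCast_atTop_atTop.comp (tendsto_atTop_mono (fun k => ?_) tendsto_id)
    simp only [id]
    omega
  have hqt : Tendsto q atTop (𝓝 0) :=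
    tendsto_inv_atTop_zero.comp (Real.tendsto_sqrt_atTop.comp hnt)
  have hqne : ∀ k, q k ≠ 0 := fun k => (hq0 k).ne'
  have hqinv : Tendsto (fun k => (q k)⁻¹) atTop atTop := by
    simp only [hq, inv_inv]
    exact Real.tendsto_sqrt_atTop.comp hnt
  have hbal' : ∀ k, ∑ i, x k i = 0 := fun k =>
    LinRegCV.sum_eq_zero_of_balanced (hx k) (hbal k)
  have hn4' : ∀ k, 4 ≤ Fintype.card (Fin (2 * k + 4)) := fun k => by
    rw [Fintype.card_fin]; omega
  set ν : (k : ℕ) → Fin (2 * k + 4) → ℝ :=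
    fun k i => β₀ + βΔ * x k i + Pi.single (M := fun _ => ℝ) (out k) m i with hν
  have hdata : ∀ k, P k = (LinRegCV.stdNormal (Fin (2 * k + 4))).map
        (fun z i => ν k i + s * z i) ∧
      ∀ i, (P k).map (fun y => y i) = gaussianReal (ν k i) (s ^ 2) := fun k => by
    have h := LinRegCV.dataLaw_eq_map (X k) ![β₀, βΔ] (Pi.single (out k) m) s
    rw [← hP, hX] at h
    simp only [LinRegCV.interceptDesign_mulVec] at h
    exact h
  set l : ℕ → ℝ := fun k => n k / 2 * Real.log ((n k - 1) / (n k - 2)) with hl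
  set l' : ℕ → ℝ := fun k => n k / 2 * Real.log ((n k + 2) / (n k + 1)) with hl'
  have hlt : Tendsto l atTop (𝓝 (1 / 2)) := LinRegCV.tendsto_loo_log hnt
  have hlt' : Tendsto l' atTop (𝓝 (1 / 2)) := LinRegCV.tendsto_elpd_log hnt
  set cl : ℕ → Fin 6 → ℝ := fun k => LinRegCV.looCoeff βΔ m τ s (q k) with hcl
  set ce : ℕ → Fin 6 → ℝ := fun k => LinRegCV.elpdCoeff τ s (q k) with hce
  set el : ℕ → ℝ := fun k => LinRegCV.looMean βΔ m τ (q k) (l k) with hel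
  set ee : ℕ → ℝ := fun k => LinRegCV.elpdMean βΔ m τ (q k) (l' k) with hee
  have exl : ∀ k z, loo k (fun i => ν k i + s * z i) =
      el k + ∑ j, cl k j * LinRegCV.noiseTerm (x k) (out k) (q k) j z := fun k z => by
    rw [hloo, hX]
    exact LinRegCV.looDiff_expansion (hx k) (hbal' k) (hout k) (hn4' k) (hcard k) (hq0 k) (hqn k)
      β₀ βΔ m hτ (fun _ => rfl) z
  have exe : ∀ k z, elpd k (fun i => ν k i + s * z i) =
      ee k + ∑ j, ce k j * LinRegCV.noiseTerm (x k) (out k) (q k) j z := fun k z => by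
    rw [helpd, hX]
    exact LinRegCV.elpdDiff_expansion (hx k) (hbal' k) (hout k) (hn4' k) (hcard k) (hq0 k) (hqn k)
      β₀ βΔ m hτ (fun _ => rfl) (hdata k).2 z
  have exr : ∀ k z, err k (fun i => ν k i + s * z i) =
      (el k - ee k) + ∑ j, (cl k j - ce k j) * LinRegCV.noiseTerm (x k) (out k) (q k) j z := by
    intro k z
    have : err k (fun i => ν k i + s * z i) =
        loo k (fun i => ν k i + s * z i) - elpd k (fun i => ν k i + s * z i) := by
      rw [herr, hloo, helpd]; rfl
    rw [this, exl, exe]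
    simp_rw [sub_mul]
    rw [Finset.sum_sub_distrib]
    ring
  have ml := fun k => LinRegCV.moments_of_noise_expansion (x k) (hx k) (out k) (hqc k) hs
    (hdata k).1 (exl k)
  have me := fun k => LinRegCV.moments_of_noise_expansion (x k) (hx k) (out k) (hqc k) hs
    (hdata k).1 (exe k)
  have mr := fun k => LinRegCV.moments_of_noise_expansion (x k) (hx k) (out k) (hqc k) hs
    (hdata k).1 (exr k)
  have posl : ∀ k, cl k 1 + q k * cl k 5 < 0 := fun k =>
    LinRegCV.looCoeff_add_neg hτ' hs' (hq12 k)
  have pose : ∀ k, 0 < ce k 1 + q k * ce k 5 := fun k =>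
    LinRegCV.elpdCoeff_add_pos (q k) hτ' hs'
  have vl : ∀ k, 0 < variance (loo k) (P k) := fun k => by
    rw [(ml k).2.2.1]
    exact LinRegCV.integral_noise_sq_pos (x k) (hx k) (hbal' k) (out k) (hqc k) (posl k).ne
  have ve : ∀ k, 0 < variance (elpd k) (P k) := fun k => by
    rw [(me k).2.2.1]
    exact LinRegCV.integral_noise_sq_pos (x k) (hx k) (hbal' k) (out k) (hqc k) (pose k).ne'
  have vr : ∀ k, 0 < variance (err k) (P k) := fun k => by
    rw [(mr k).2.2.1]
    refine LinRegCV.integral_noise_sq_pos (x k) (hx k) (hbal' k) (out k) (hqc k)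
      (ne_of_lt ?_)
    linarith [posl k, pose k]
  have rl : ∀ k, LinRegCV.meanOverSD (P k) (loo k) = el k / √(variance (loo k) (P k)) := fun k => by
    rw [LinRegCV.meanOverSD, (ml k).2.1]
  have re : ∀ k, LinRegCV.meanOverSD (P k) (elpd k) = ee k / √(variance (elpd k) (P k)) :=
    fun k => by rw [LinRegCV.meanOverSD, (me k).2.1]
  have rr : ∀ k, LinRegCV.meanOverSD (P k) (err k) = (el k - ee k) / √(variance (err k) (P k)) :=
    fun k => by rw [LinRegCV.meanOverSD, (mr k).2.1]
  have sc : (s : ℝ) ^ 2 / (2 * τ ^ 2) ≠ 0 := by positivity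
  have scale := fun {c : ℕ → Fin 6 → ℝ} {lam : ℕ → ℝ} {a b : ℝ}
    (h : ∀ j, Tendsto (fun k => lam k * c k j) atTop (𝓝 (![a, b, 0, 0, 0, 0] j))) {V T : ℕ → ℝ} =>
      LinRegCV.tendsto_rescaled_moments hx (out := out) hqc h (V := V) (T := T)
  have lime : ∀ j, Tendsto (fun k => 1 * ce k j) atTop
      (𝓝 (![0, (s : ℝ) ^ 2 / (2 * τ ^ 2), 0, 0, 0, 0] j)) := fun j => by
    simp only [one_mul]
    exact LinRegCV.tendsto_elpdCoeff hqt hqne τ s j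
  have Le := scale lime (fun k => (me k).2.2.1) (fun k => (me k).2.2.2)
  have valE : (1 / 2 : ℝ) / √(0 ^ 2 + 2 * ((s : ℝ) ^ 2 / (2 * τ ^ 2)) ^ 2) =
      (τ : ℝ) ^ 2 / (√2 * (s : ℝ) ^ 2) := by
    rw [zero_pow two_ne_zero, zero_add, Real.sqrt_mul zero_le_two, Real.sqrt_sq (by positivity)]
    field_simp
  have limq : ∀ j, Tendsto (fun k => q k * cl k j) atTop
      (𝓝 (![-(s * βΔ / τ ^ 2), 0, 0, 0, 0, 0] j)) :=
    LinRegCV.tendsto_mul_looCoeff hqt hqne βΔ m τ s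
  have limqr : ∀ j, Tendsto (fun k => q k * (cl k j - ce k j)) atTop
      (𝓝 (![-(s * βΔ / τ ^ 2), 0, 0, 0, 0, 0] j)) := fun j => by
    have h := (limq j).sub (hqt.mul (LinRegCV.tendsto_elpdCoeff hqt hqne τ s j))
    rw [zero_mul, sub_zero] at h
    exact h.congr fun k => by ring
  have Wq : βΔ ≠ 0 → 0 < (-((s : ℝ) * βΔ / τ ^ 2)) ^ 2 + 2 * (0 : ℝ) ^ 2 := fun hβ => by
    have : 0 < ((s : ℝ) * βΔ / τ ^ 2) ^ 2 := by positivity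
    rw [neg_sq]
    linarith
  have W1 : ∀ u : ℝ, u ≠ 0 → 0 < (0 : ℝ) ^ 2 + 2 * u ^ 2 := fun u hu => by positivity
  have liml : βΔ = 0 → ∀ j, Tendsto (fun k => 1 * cl k j) atTop
      (𝓝 (![0, -((s : ℝ) ^ 2 / (2 * τ ^ 2)), 0, 0, 0, 0] j)) := fun hβ j => by
    simp only [one_mul, hcl, hβ]
    exact LinRegCV.tendsto_looCoeff_zero hqt hqne m τ s j
  -- The limits have opposite signs, so subtraction doubles the coefficient of `W ^ 2 - 1`.
  have limr : βΔ = 0 → ∀ j, Tendsto (fun k => 1 * (cl k j - ce k j)) atTop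
      (𝓝 (![0, -((s : ℝ) ^ 2 / τ ^ 2), 0, 0, 0, 0] j)) := fun hβ j => by
    have h := (liml hβ j).sub (lime j)
    simp only [one_mul] at h ⊢
    convert! h using 2
    fin_cases j <;> simp
    field_simp
    ring
  have meanr : Tendsto (fun k => q k * (el k - ee k)) atTop (𝓝 0) :=
    LinRegCV.tendsto_mul_sub_mean hqt hqne hq1 βΔ m τ hlt hlt'
  have neg : βΔ ≠ 0 → -(βΔ ^ 2 / (2 * (τ : ℝ) ^ 2)) < 0 := fun hβ => by
    have : 0 < βΔ ^ 2 / (2 * (τ : ℝ) ^ 2) := by positivity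
    linarith
  refine ⟨fun k => ⟨⟨(ml k).1, vl k⟩, ⟨(me k).1, ve k⟩, ⟨(mr k).1, vr k⟩⟩, fun hβ => ?_, fun hβ => ?_,
    fun hβ => ?_, fun hβ => ?_, ?_, fun hβ => ?_, fun hβ => ?_⟩
  · simp_rw [rl]
    have L := scale (liml hβ) (fun k => (ml k).2.2.1) (fun k => (ml k).2.2.2)
    have h := LinRegCV.tendsto_div_sqrt (e := el) (E := 1 / 2) (fun _ => one_pos)
      (W1 _ (neg_ne_zero.2 sc)) (by
        simp only [one_mul, hel, hβ, LinRegCV.looMean_zero]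
        exact hlt) L.1
    rwa [neg_sq, valE] at h
  · simp_rw [rl]
    have L := scale limq (fun k => (ml k).2.2.1) (fun k => (ml k).2.2.2)
    refine LinRegCV.tendsto_div_sqrt_atBot hq0 (Wq hβ) ?_ L.1
    -- The mean scaled by `q` is `q ^ 2 * mean`, with a negative limit, times `q⁻¹`.
    have h := (LinRegCV.tendsto_sq_mul_looMean hqt hqne βΔ m τ hlt).neg_mul_atTop (neg hβ) hqinv
    refine h.congr fun k => ?_
    have := hqne k
    simp only [hel]
    field_simp
  · simp_rw [re]
    have h := LinRegCV.tendsto_div_sqrt (e := ee) (E := 1 / 2) (fun _ => one_pos) (W1 _ sc) (by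
        simp only [one_mul, hee, hβ]
        exact LinRegCV.tendsto_elpdMean_zero hqt hqne m τ hlt') Le.1
    rwa [valE] at h
  · simp_rw [re]
    refine LinRegCV.tendsto_div_sqrt_atBot (fun _ => one_pos) (W1 _ sc) ?_ Le.1
    -- The elpd variance converges without scaling, so the full growth `q⁻¹ * q⁻¹ = n` of the mean
    -- remains.
    have h := (LinRegCV.tendsto_sq_mul_elpdMean hqt hqne βΔ m τ hlt').neg_mul_atTop (neg hβ)
      (hqinv.atTop_mul_atTop₀ hqinv)
    refine h.congr fun k => ?_
    have := hqne k
    simp only [hee]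
    field_simp
  · simp_rw [rr]
    rcases eq_or_ne βΔ 0 with hβ | hβ
    · have L := scale (limr hβ) (fun k => (mr k).2.2.1) (fun k => (mr k).2.2.2)
      have h := LinRegCV.tendsto_div_sqrt (e := fun k => el k - ee k) (E := 0) (fun _ => one_pos)
        (W1 _ (neg_ne_zero.2 (by positivity))) (by
          simp only [one_mul, hel, hee, hβ, LinRegCV.looMean_zero]
          simpa using hlt.sub (LinRegCV.tendsto_elpdMean_zero hqt hqne m τ hlt')) L.1
      rwa [zero_div] at h
    · have L := scale limqr (fun k => (mr k).2.2.1) (fun k => (mr k).2.2.2)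
      have h := LinRegCV.tendsto_div_sqrt (e := fun k => el k - ee k) hq0 (Wq hβ) meanr L.1
      rwa [zero_div] at h
  · have L := scale (limr hβ) (fun k => (mr k).2.2.1) (fun k => (mr k).2.2.2)
    have h := LinRegCV.tendsto_div_rpow (fun _ => one_pos) vr
      (W1 _ (neg_ne_zero.2 (by positivity))) L.2 L.1
    -- The skewness of `-u * (W ^ 2 - 1)` is `-8 * u ^ 3 / (2 * u ^ 2) ^ (3 / 2)`, independent of
    -- `u`.
    have val : ∀ u : ℝ, 0 < u → (8 * (-u) ^ 3 + 6 * 0 ^ 2 * -u) /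
        (0 ^ 2 + 2 * (-u) ^ 2) ^ (3 / 2 : ℝ) = -(2 : ℝ) ^ (3 / 2 : ℝ) := by
      intro u hu
      have e1 : (2 * u ^ 2) ^ (3 / 2 : ℝ) = (2 : ℝ) ^ (3 / 2 : ℝ) * u ^ 3 := by
        rw [Real.mul_rpow (by norm_num) (by positivity), ← Real.rpow_natCast u 2,
          ← Real.rpow_mul hu.le, ← Real.rpow_natCast u 3]
        norm_num
      have e2 : (2 : ℝ) ^ (3 / 2 : ℝ) * (2 : ℝ) ^ (3 / 2 : ℝ) = 8 := by
        rw [← Real.rpow_add two_pos]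
        norm_num
      have e3 := Real.rpow_pos_of_pos (two_pos (α := ℝ)) (3 / 2)
      rw [neg_sq, zero_pow two_ne_zero, zero_add, e1, div_eq_iff (by positivity)]
      linear_combination u ^ 3 * e2
    rw [val _ (by positivity)] at h
    exact h
  · have L := scale limqr (fun k => (mr k).2.2.1) (fun k => (mr k).2.2.2)
    -- The limit is linear in `W`, so its third moment `8 * 0 ^ 3 + 6 * a ^ 2 * 0` vanishes.
    have h := LinRegCV.tendsto_div_rpow hq0 vr (Wq hβ) L.2 L.1
    simpa [LinRegCV.skewness] using h
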